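/- All logarithms are to base 2; entropies are Shannon entropies in bits, with values in $[0,\infty]$. **Protocols.** Three parties, Alice (1), Bob (2) and Charlie (3), are connected by private links $12$, $23$, $31$. Alice has an input $X\in\mathcal X$, Bob has an input $Y\in\mathcal Y$. The protocol proceeds in rounds; in each round every party $i$ sends each of the other two parties a finite bit string (possibly empty), the pair of strings being drawn, with fresh independent randomness, from a distribution that depends only on the input of party $i$ (if any) and on the messages sent in earlier rounds over the two links of party $i$. Each message is a codeword of a prefix-free code which, for each direction of a link, is determined by the messages sent in earlier rounds over the same link. With probability 1 the protocol terminates, i.e. reaches a state from which on all messages are empty. The transcript $M_{ij}$ consists of the two strings obtained by concatenating all bits sent over the link $ij$ in each of the two directions. At the end Charlie produces an output $Z$, drawn from a distribution that depends only on $(M_{23},M_{31})$. Put $M_1=(M_{12},M_{31})$, $M_2=(M_{12},M_{23})$, $M_3=(M_{23},M_{31})$, and let $V_1=(M_1,X)$, $V_2=(M_2,Y)$, $V_3=(M_3,Z)$ be the views. **Security.** A protocol is *secure* for a function $f:\mathcal X\times\mathcal Y\to\mathcal Z$ and an input distribution $p_{XY}$ if $Z=f(x,y)$ with probability 1 for all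 inputs $(x,y)$ with $p_{XY}(x,y)>0$, and if, for inputs distributed according to $p_{XY}$, the Markov chains $M_1-X-(Y,Z)$, $M_2-Y-(X,Z)$ and $M_3-Z-(X,Y)$ hold. The *randomness* required is $\rho(p_{XY},f)=\inf H(V_1,V_2,V_3\mid X,Y)$, the infimum being over all secure protocols for $f$ and $p_{XY}$. **CMSS.** A *correlated multi-secret sharing scheme* (CMSS) for a joint distribution $p_{XYZ}$ is a randomized map from $(X,Y,Z)$ to shares $(M_{12},M_{23},M_{31})$ such that $H(X\mid M_{12},M_{31})=H(Y\mid M_{12},M_{23})=H(Z\mid M_{23},M_{31})=0$ and the Markov chains $(M_{12},M_{31})-X-(Y,Z)$, $(M_{12},M_{23})-Y-(X,Z)$, $(M_{23},M_{31})-Z-(X,Y)$ hold. **Theorem.** (a) Let $n\ge 0$, let $p_{XY}$ be a distribution with full support on $\{0,1\}^n\times\{0,1\}^n$, and let $\mathrm{AND}(x,y)=x\wedge y\in\{0,1\}^n$ be the bitwise AND. Every secure protocol for $\mathrm{AND}$ and $p_{XY}$, which may depend on $p_{XY}$, satisfies $$H(M_{31})\ge n\log 3,\qquad H(M_{23})\ge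 n\log 3,\qquad H(M_{12})\ge 1.826\,n,$$ and moreover $\rho(p_{XY},\mathrm{AND})\ge 1.826\,n$. (b) In contrast, if $X,Y$ are independent uniformly distributed bits and $Z=X\wedge Y$, there is a CMSS for $p_{XYZ}$ with $H(M_{12})=H(M_{23})=H(M_{31})=\log 3$, and $\log 3<1.826$. -/

import Mathlib

open scoped ENNReal

noncomputable section

/-! ### Entropy of discrete random variables (base 2, with values in `[0, ∞]`) -/

/-- Shannon entropy `H(T)` in bits of the random variable `T` under the law `μ`. -/
def entropy {Ω α : Type} (μ : PMF Ω) (T : Ω → α) : ℝ≥0∞ :=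
  ∑' t, ENNReal.ofReal (Real.negMulLog ((μ.map T) t).toReal / Real.log 2)

/-- Conditional entropy `H(T | U) = ∑ p(t,u) log (p(u) / p(t,u))` in bits. -/
def condEntropy {Ω α β : Type} (μ : PMF Ω) (T : Ω → α) (U : Ω → β) : ℝ≥0∞ :=
  ∑' c : α × β, ENNReal.ofReal
    (((μ.map fun ω => (T ω, U ω)) c).toReal *
      Real.logb 2 (((μ.map U) c.2).toReal / ((μ.map fun ω => (T ω, U ω)) c).toReal))

/-- The Markov chain `T - U - V`: `T` and `V` are conditionally independent given `U`. -/
def MarkovChain {Ω α β γ : Type} (μ : PMF Ω) (T : Ω → α) (U : Ω → β) (V : Ω → γ) : Prop :=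
  ∀ t u v,
    (μ.map fun ω => (T ω, U ω, V ω)) (t, u, v) * (μ.map U) u =
      (μ.map fun ω => (T ω, U ω)) (t, u) * (μ.map fun ω => (U ω, V ω)) (u, v)

/-! ### Three-party protocols -/

/-- A message: a finite bit string. -/
abbrev Word : Type := List Bool

/-- A pair of words travelling over one link in the two directions. On link `12` it is
(from 1 to 2, from 2 to 1), on link `23` (from 2 to 3, from 3 to 2), and on link `31`
(from 3 to 1, from 1 to 3). -/
abbrev Exchange : Type := Word × Word

/-- The messages sent over one link so far, round by round, oldest round first. -/
abbrev LinkHistory : Type := List Exchange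

/-- One piece of data for each of the three links. -/
@[ext] structure Links (α : Type) where
  l12 : α
  l23 : α
  l31 : α

/-- All messages sent so far. -/
abbrev History : Type := Links LinkHistory

/-- A final transcript: for each link, the concatenations of the bits sent in each direction. -/
abbrev Transcript : Type := Links Exchange

/-- Append the messages of one round. -/
def History.append (h : History) (r : Links Exchange) : History :=
  ⟨h.l12 ++ [r.l12], h.l23 ++ [r.l23], h.l31 ++ [r.l31]⟩

/-- The history `h` followed by `k` rounds in which only empty strings are sent. -/
def History.silence (h : History) (k : ℕ) : History :=
  ⟨h.l12 ++ List.replicate k ([], []), h.l23 ++ List.replicate k ([], []),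
    h.l31 ++ List.replicate k ([], [])⟩

/-- Concatenate the bits sent over a link, separately for the two directions. -/
def LinkHistory.concat (l : LinkHistory) : Exchange :=
  ((l.map Prod.fst).flatten, (l.map Prod.snd).flatten)

/-- The transcript of a history. -/
def History.transcript (h : History) : Transcript :=
  ⟨LinkHistory.concat h.l12, LinkHistory.concat h.l23, LinkHistory.concat h.l31⟩

/-- The next-message functions of the three parties and the output function of Charlie.
In every round each party draws, with fresh private randomness, a message for each of the two
other parties, from a distribution that depends on its input and on all earlier messages on its two
links. Charlie has no input, and only Charlie has an output. -/
structure NextMessage (X Y Z : Type) where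
  /-- input, link `12`, link `31` ↦ (message to Bob, message to Charlie) -/
  alice : X → LinkHistory → LinkHistory → PMF (Word × Word)
  /-- input, link `12`, link `23` ↦ (message to Alice, message to Charlie) -/
  bob : Y → LinkHistory → LinkHistory → PMF (Word × Word)
  /-- link `23`, link `31` ↦ (message to Alice, message to Bob) -/
  charlie : LinkHistory → LinkHistory → PMF (Word × Word)
  /-- final transcripts on links `23` and `31` ↦ distribution of Charlie's output -/
  output : Exchange → Exchange → PMF Z

namespace NextMessage

variable {X Y Z : Type} (P : NextMessage X Y Z)

/-- The messages of the next round, after the history `h`, on inputs `x`, `y`. -/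
def round (x : X) (y : Y) (h : History) : PMF (Links Exchange) :=
  (P.alice x h.l12 h.l31).bind fun a =>
    (P.bob y h.l12 h.l23).bind fun b =>
      (P.charlie h.l23 h.l31).map fun c => ⟨(a.1, b.1), (b.2, c.2), (c.1, a.2)⟩

/-- The law of the history after `t` rounds on inputs `x`, `y`. -/
def run (x : X) (y : Y) : ℕ → PMF History
  | 0 => PMF.pure ⟨[], [], []⟩
  | t + 1 => (run x y t).bind fun h => (P.round x y h).map h.append

/-- The protocol has terminated in the state `(x, y, h)`: from here on all parties send
empty strings only. -/
def Halted (x : X) (y : Y) (h : History) : Prop :=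
  ∀ k : ℕ, P.round x y (h.silence k) = PMF.pure ⟨([], []), ([], []), ([], [])⟩

/-- The probability that, on inputs `x`, `y`, the protocol terminates with the final
transcript `m`. (The probabilities on the right are nondecreasing in `t`.) -/
def transcriptProb (x : X) (y : Y) (m : Transcript) : ℝ≥0∞ :=
  ⨆ t : ℕ, (P.run x y t).toOuterMeasure {h | P.Halted x y h ∧ h.transcript = m}

end NextMessage

/-- No word of the code is a proper prefix of another one. -/
def IsPrefixFree (C : Set Word) : Prop :=
  ∀ u ∈ C, ∀ v ∈ C, u <+: v → u = v

/-- A choice of a prefix-free code for each direction of a link, as a function of the earlier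
messages on that link. -/
structure LinkCode where
  fwd : LinkHistory → Set Word
  bwd : LinkHistory → Set Word
  fwd_prefixFree : ∀ l, IsPrefixFree (fwd l)
  bwd_prefixFree : ∀ l, IsPrefixFree (bwd l)

/-- The exchange `e`, coming after the link history `l`, consists of codewords. -/
def LinkCode.Allows (C : LinkCode) (l : LinkHistory) (e : Exchange) : Prop :=
  e.1 ∈ C.fwd l ∧ e.2 ∈ C.bwd l

/-- A well-formed three-party protocol in which Alice has an input in `X`, Bob has an input in `Y`,
and Charlie produces an output in `Z`. -/
structure Protocol (X Y Z : Type) extends NextMessage X Y Z where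
  /-- Every message sent in an execution is a codeword of a prefix-free code that is determined
  by the earlier messages on the same link. -/
  prefixFree : ∃ C : Links LinkCode, ∀ x y t, ∀ h ∈ (toNextMessage.run x y t).support,
    ∀ r ∈ (toNextMessage.round x y h).support,
      C.l12.Allows h.l12 r.l12 ∧ C.l23.Allows h.l23 r.l23 ∧ C.l31.Allows h.l31 r.l31
  /-- The protocol terminates with probability 1. -/
  terminates : ∀ x y, ∑' m, toNextMessage.transcriptProb x y m = 1

/-- An outcome of an execution: the inputs, Charlie's output and the final transcript. -/
structure Outcome (X Y Z : Type) where
  x : X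
  y : Y
  z : Z
  m : Transcript

namespace Outcome

variable {X Y Z : Type}

def M12 (ω : Outcome X Y Z) : Exchange := ω.m.l12
def M23 (ω : Outcome X Y Z) : Exchange := ω.m.l23
def M31 (ω : Outcome X Y Z) : Exchange := ω.m.l31

/-- The transcripts that party 1 (Alice) sees. -/
def M1 (ω : Outcome X Y Z) : Exchange × Exchange := (ω.M12, ω.M31)
/-- The transcripts that party 2 (Bob) sees. -/
def M2 (ω : Outcome X Y Z) : Exchange × Exchange := (ω.M12, ω.M23)
/-- The transcripts that party 3 (Charlie) sees. -/
def M3 (ω : Outcome X Y Z) : Exchange × Exchange := (ω.M23, ω.M31)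

/-- The view of party 1. -/
def V1 (ω : Outcome X Y Z) : (Exchange × Exchange) × X := (ω.M1, ω.x)
/-- The view of party 2. -/
def V2 (ω : Outcome X Y Z) : (Exchange × Exchange) × Y := (ω.M2, ω.y)
/-- The view of party 3. -/
def V3 (ω : Outcome X Y Z) : (Exchange × Exchange) × Z := (ω.M3, ω.z)

end Outcome

namespace Protocol

variable {X Y Z : Type} (P : Protocol X Y Z)

/-- The law of the final transcript on inputs `x`, `y`. -/
def transcriptLaw (x : X) (y : Y) : PMF Transcript :=
  ⟨P.toNextMessage.transcriptProb x y, P.terminates x y ▸ ENNReal.summable.hasSum⟩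

/-- The joint law of inputs, output and transcripts when the inputs have the law `pXY`. -/
def law (pXY : PMF (X × Y)) : PMF (Outcome X Y Z) :=
  pXY.bind fun xy =>
    (P.transcriptLaw xy.1 xy.2).bind fun m =>
      (P.output m.l23 m.l31).map fun z => ⟨xy.1, xy.2, z, m⟩

/-- `P` is a perfectly secure protocol for `(pXY, pZ)`, where `pZ x y` is the law that the
output is to have on inputs `x`, `y`. -/
structure Secure (pXY : PMF (X × Y)) (pZ : X → Y → PMF Z) : Prop where
  correct : ∀ x y, pXY (x, y) ≠ 0 →
    ((P.transcriptLaw x y).bind fun m => P.output m.l23 m.l31) = pZ x y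
  private_alice : MarkovChain (P.law pXY) Outcome.M1 Outcome.x fun ω => (ω.y, ω.z)
  private_bob : MarkovChain (P.law pXY) Outcome.M2 Outcome.y fun ω => (ω.x, ω.z)
  private_charlie : MarkovChain (P.law pXY) Outcome.M3 Outcome.z fun ω => (ω.x, ω.y)

end Protocol

/-- The randomness `ρ(pXY, pZ)` required to securely compute `pZ` for the input law `pXY`: the
infimum of `H(V₁, V₂, V₃ | X, Y)` over all secure protocols. -/
def randomness {X Y Z : Type} (pXY : PMF (X × Y)) (pZ : X → Y → PMF Z) : ℝ≥0∞ :=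
  ⨅ (P : Protocol X Y Z) (_ : P.Secure pXY pZ),
    condEntropy (P.law pXY) (fun ω => (ω.V1, ω.V2, ω.V3)) fun ω => (ω.x, ω.y)

/-- The deterministic functionality that gives Charlie the bitwise AND of the two inputs. -/
def andFn (n : ℕ) (x y : Fin n → Bool) : PMF (Fin n → Bool) :=
  PMF.pure fun i => x i && y i

/-! ### Correlated multi-secret sharing -/

/-- Secrets and shares. -/
structure Sharing (X Y Z S₁₂ S₂₃ S₃₁ : Type) where
  x : X
  y : Y
  z : Z
  m12 : S₁₂
  m23 : S₂₃
  m31 : S₃₁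

/-- The joint law of secrets and shares, when the secrets have the law `pXYZ` and a dealer
maps them to shares by means of `σ`. -/
def sharingLaw {X Y Z S₁₂ S₂₃ S₃₁ : Type} (pXYZ : PMF (X × Y × Z))
    (σ : X → Y → Z → PMF (S₁₂ × S₂₃ × S₃₁)) : PMF (Sharing X Y Z S₁₂ S₂₃ S₃₁) :=
  pXYZ.bind fun s => (σ s.1 s.2.1 s.2.2).map fun m =>
    ⟨s.1, s.2.1, s.2.2, m.1, m.2.1, m.2.2⟩

/-- `σ` is a correlated multi-secret sharing scheme for the joint law `pXYZ`. -/
structure IsCMSS {X Y Z S₁₂ S₂₃ S₃₁ : Type} (pXYZ : PMF (X × Y × Z))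
    (σ : X → Y → Z → PMF (S₁₂ × S₂₃ × S₃₁)) : Prop where
  correct_alice : condEntropy (sharingLaw pXYZ σ) (fun ω => ω.x) (fun ω => (ω.m12, ω.m31)) = 0
  correct_bob : condEntropy (sharingLaw pXYZ σ) (fun ω => ω.y) (fun ω => (ω.m12, ω.m23)) = 0
  correct_charlie : condEntropy (sharingLaw pXYZ σ) (fun ω => ω.z) (fun ω => (ω.m23, ω.m31)) = 0
  private_alice : MarkovChain (sharingLaw pXYZ σ)
    (fun ω => (ω.m12, ω.m31)) (fun ω => ω.x) (fun ω => (ω.y, ω.z))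
  private_bob : MarkovChain (sharingLaw pXYZ σ)
    (fun ω => (ω.m12, ω.m23)) (fun ω => ω.y) (fun ω => (ω.x, ω.z))
  private_charlie : MarkovChain (sharingLaw pXYZ σ)
    (fun ω => (ω.m23, ω.m31)) (fun ω => ω.z) (fun ω => (ω.x, ω.y))

/-- The law of `(X, Y, X ∧ Y)` for independent uniformly distributed bits `X`, `Y`. -/
def uniformAnd : PMF (Bool × Bool × Bool) :=
  (PMF.uniformOfFintype (Bool × Bool)).map fun b => (b.1, b.2, b.1 && b.2)

end

/-! The lower bounds are proved in nats and rest on freedom in choosing the inputs. Since `pXY` has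
full support, security is a statement about the kernel `(x, y) ↦` law of the transcript, collected
in `PrivateAnd`: the law of each party's transcripts depends only on that party's input or output,
and those transcripts determine it. For Alice and Bob the second half is not assumed; it follows
from a cut-and-paste argument on supports (`Protocol.Secure.alice_det`). Any input law may then be
put in front of the kernel, and each single link has a law that does not depend on the inputs.

Links `31` and `23` (`PrivateAnd.le_ent_l31` and its mirror image): H(M31 | M23) = H(Z) + H(M31 | Z,
M23), and the last term depends only on the law of Z. It may therefore be evaluated with Y = Z and X
still random where Z = 0, and there it is at least H(X | Y). With P(Z_i = 1) = 1/3 the sum is n log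
3.

Link `12` needs the interaction of the protocol. If U consists of both inputs and link `12`, V is
link `31` and W is link `23`, then I(U; V | W) ≤ I(U; V). This holds trivially at the start and
survives every message (`NextMessage.interactionNonneg_run`). When Y is also the output, it gives
H(M12) ≥ H(X, Y) + H(M12 | X, M31) (`InteractionNonneg.ent_secret_le`, `PrivateAnd.ent_inputs_le`).
The last term depends only on the law of X, so Bob's input law may be replaced by one for which the
output is always 0, and then the term is at least H(Y | X) (`PrivateAnd.cEnt_bob_input_le`). With X
uniform the two contributions add up to 2n bits, more than the required 1.826 n.

The number of rounds is unbounded, so the interaction inequality is applied to the first t rounds.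
Prefix-freeness recovers these from the transcript link by link; correctness then holds only up to
conditional entropies that tend to 0 by a Fano argument (`tendsto_cEnt_of_eventually_guess`).

The randomness bound follows because M12 is part of the views and is independent of the inputs. Part
(b) is an explicit scheme over the integers modulo 3, checked by counting. -/

noncomputable section

/-! ### Entropy calculus for discrete random variables -/

section InformationCalculus

variable {Ω Ω' α β γ δ : Type}

/-- The random variable `(A, B)`. -/
abbrev pair (A : Ω → α) (B : Ω → β) : Ω → α × β := fun ω => (A ω, B ω)

/-- The probability of the fibre of `T` through `ω`. -/
def fiberProb (μ : PMF Ω) (T : Ω → α) (ω : Ω) : ℝ≥0∞ := μ.map T (T ω)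

/-- The logarithm of the probability of the fibre of `T` through `ω`. -/
def logProb (μ : PMF Ω) (T : Ω → α) (ω : Ω) : ℝ := Real.log (fiberProb μ T ω).toReal

/-- Conditional entropy in nats, as the expectation of the conditional information content. -/
def cEnt (μ : PMF Ω) (T : Ω → α) (C : Ω → β) : ℝ≥0∞ :=
  ∑' ω, μ ω * ENNReal.ofReal (logProb μ C ω - logProb μ (pair T C) ω)

/-- Entropy in nats. -/
def ent (μ : PMF Ω) (T : Ω → α) : ℝ≥0∞ := cEnt μ T fun _ => ()

/-- Conditional independence of `A` and `B` given `C`, pointwise on the support. -/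
def CondIndep (μ : PMF Ω) (A : Ω → α) (B : Ω → β) (C : Ω → γ) : Prop :=
  ∀ ω, μ ω ≠ 0 → fiberProb μ (pair A (pair B C)) ω * fiberProb μ C ω =
    fiberProb μ (pair A C) ω * fiberProb μ (pair B C) ω

theorem fiberProb_eq_tsum (μ : PMF Ω) (T : Ω → α) (ω : Ω) [∀ ω', Decidable (T ω' = T ω)] :
    fiberProb μ T ω = ∑' ω', if T ω' = T ω then μ ω' else 0 := by
  classical
  simp only [fiberProb, PMF.map_apply, eq_comm]

theorem fiberProb_ne_top (μ : PMF Ω) (T : Ω → α) (ω : Ω) : fiberProb μ T ω ≠ ∞ :=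
  PMF.apply_ne_top _ _

theorem le_fiberProb (μ : PMF Ω) (T : Ω → α) (ω : Ω) : μ ω ≤ fiberProb μ T ω := by
  classical
  rw [fiberProb_eq_tsum]
  simpa using ENNReal.le_tsum (f := fun ω' => if T ω' = T ω then μ ω' else 0) ω

theorem fiberProb_ne_zero {μ : PMF Ω} (T : Ω → α) {ω : Ω} (h : μ ω ≠ 0) :
    fiberProb μ T ω ≠ 0 :=
  fun h0 => h (le_antisymm (h0 ▸ le_fiberProb μ T ω) bot_le)

theorem fiberProb_mono {μ : PMF Ω} {T : Ω → α} {T' : Ω → β} {ω : Ω}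
    (h : ∀ ω', μ ω' ≠ 0 → T ω' = T ω → T' ω' = T' ω) : fiberProb μ T ω ≤ fiberProb μ T' ω := by
  classical
  rw [fiberProb_eq_tsum, fiberProb_eq_tsum]
  refine ENNReal.tsum_le_tsum fun ω' => ?_
  by_cases h0 : μ ω' = 0
  · simp [h0]
  · split_ifs with h1 h2
    · exact le_rfl
    · exact absurd (h ω' h0 h1) h2
    · exact bot_le
    · exact le_rfl

theorem fiberProb_congr {μ : PMF Ω} {T : Ω → α} {T' : Ω → β} {ω : Ω}
    (h : ∀ ω', μ ω' ≠ 0 → (T ω' = T ω ↔ T' ω' = T' ω)) : fiberProb μ T ω = fiberProb μ T' ω :=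
  le_antisymm (fiberProb_mono fun ω' h0 => (h ω' h0).1) (fiberProb_mono fun ω' h0 => (h ω' h0).2)

theorem fiberProb_map (μ : PMF Ω) (f : Ω → Ω') (T : Ω' → α) (ω : Ω) :
    fiberProb (μ.map f) T (f ω) = fiberProb μ (T ∘ f) ω := by
  simp only [fiberProb, PMF.map_comp, Function.comp_apply]

theorem fiberProb_const (μ : PMF Ω) (c : α) (ω : Ω) : fiberProb μ (fun _ => c) ω = 1 := by
  classical
  rw [fiberProb_eq_tsum]
  simp

theorem logProb_const (μ : PMF Ω) (c : α) (ω : Ω) : logProb μ (fun _ => c) ω = 0 := by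
  simp [logProb, fiberProb_const]

theorem logProb_mono {μ : PMF Ω} {T : Ω → α} {T' : Ω → β} {ω : Ω} (h0 : μ ω ≠ 0)
    (h : ∀ ω', μ ω' ≠ 0 → T ω' = T ω → T' ω' = T' ω) : logProb μ T ω ≤ logProb μ T' ω :=
  Real.log_le_log (ENNReal.toReal_pos (fiberProb_ne_zero T h0) (fiberProb_ne_top _ _ _))
    (ENNReal.toReal_mono (fiberProb_ne_top _ _ _) (fiberProb_mono h))

theorem logProb_congr {μ : PMF Ω} {T : Ω → α} {T' : Ω → β} {ω : Ω}
    (h : ∀ ω', μ ω' ≠ 0 → (T ω' = T ω ↔ T' ω' = T' ω)) : logProb μ T ω = logProb μ T' ω := by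
  rw [logProb, logProb, fiberProb_congr h]

theorem logProb_pair_le {μ : PMF Ω} (T : Ω → α) (C : Ω → β) {ω : Ω} (h0 : μ ω ≠ 0) :
    logProb μ (pair T C) ω ≤ logProb μ C ω :=
  logProb_mono h0 fun _ _ h => (Prod.mk.inj h).2

theorem tsum_map_mul (μ : PMF Ω) (f : Ω → Ω') (g : Ω' → ℝ≥0∞) :
    ∑' b, μ.map f b * g b = ∑' ω, μ ω * g (f ω) := by
  classical
  simp only [PMF.map_apply, ← ENNReal.tsum_mul_right]
  rw [ENNReal.tsum_comm]
  refine tsum_congr fun ω => ?_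
  rw [tsum_eq_single (f ω)]
  · simp
  · intro b hb
    simp [hb]

theorem expect_congr {μ : PMF Ω} {f g : Ω → ℝ≥0∞} (h : ∀ ω, μ ω ≠ 0 → f ω = g ω) :
    ∑' ω, μ ω * f ω = ∑' ω, μ ω * g ω := by
  refine tsum_congr fun ω => ?_
  by_cases h0 : μ ω = 0
  · simp [h0]
  · rw [h ω h0]

theorem expect_mono {μ : PMF Ω} {f g : Ω → ℝ≥0∞} (h : ∀ ω, μ ω ≠ 0 → f ω ≤ g ω) :
    ∑' ω, μ ω * f ω ≤ ∑' ω, μ ω * g ω := by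
  refine ENNReal.tsum_le_tsum fun ω => ?_
  by_cases h0 : μ ω = 0
  · simp [h0]
  · gcongr
    exact h ω h0

theorem expect_const (μ : PMF Ω) (c : ℝ≥0∞) : ∑' ω, μ ω * c = c := by
  rw [ENNReal.tsum_mul_right, μ.tsum_coe, one_mul]

theorem cEnt_map (μ : PMF Ω) (f : Ω → Ω') (T : Ω' → α) (C : Ω' → β) :
    cEnt (μ.map f) T C = cEnt μ (T ∘ f) (C ∘ f) := by
  rw [cEnt, tsum_map_mul]
  simp only [logProb, fiberProb_map]
  rfl

theorem ent_map (μ : PMF Ω) (f : Ω → Ω') (T : Ω' → α) : ent (μ.map f) T = ent μ (T ∘ f) :=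
  cEnt_map μ f T _

theorem cEnt_congr {μ : PMF Ω} {T : Ω → α} {C : Ω → β} {T' : Ω → γ} {C' : Ω → δ}
    (hC : ∀ ω ω', μ ω ≠ 0 → μ ω' ≠ 0 → (C ω' = C ω ↔ C' ω' = C' ω))
    (hT : ∀ ω ω', μ ω ≠ 0 → μ ω' ≠ 0 →
      (T ω' = T ω ∧ C ω' = C ω ↔ T' ω' = T' ω ∧ C' ω' = C' ω)) :
    cEnt μ T C = cEnt μ T' C' := by
  refine expect_congr fun ω h0 => ?_
  rw [logProb_congr fun ω' h' => hC ω ω' h0 h', logProb_congr (T := pair T C) (T' := pair T' C')]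
  intro ω' h'
  simpa only [Prod.mk.injEq] using hT ω ω' h0 h'

/-- A conditional entropy of a quantity that is determined by more data is larger. -/
theorem cEnt_mono_left {μ : PMF Ω} {T : Ω → α} {T' : Ω → γ} {C : Ω → β}
    (h : ∀ ω ω', μ ω ≠ 0 → μ ω' ≠ 0 → T' ω' = T' ω → C ω' = C ω → T ω' = T ω) :
    cEnt μ T C ≤ cEnt μ T' C := by
  refine expect_mono fun ω h0 => ENNReal.ofReal_le_ofReal (sub_le_sub_left ?_ _)
  refine logProb_mono h0 fun ω' h' he => ?_
  simp only [Prod.mk.injEq] at he ⊢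
  exact ⟨h ω ω' h0 h' he.1 he.2, he.2⟩

theorem cEnt_eq_zero {μ : PMF Ω} {T : Ω → α} {C : Ω → β}
    (h : ∀ ω ω', μ ω ≠ 0 → μ ω' ≠ 0 → C ω' = C ω → T ω' = T ω) : cEnt μ T C = 0 := by
  refine ENNReal.tsum_eq_zero.2 fun ω => ?_
  by_cases h0 : μ ω = 0
  · simp [h0]
  · rw [logProb_congr (T' := C) (T := pair T C) fun ω' h' => ?_]
    · simp
    · simp only [Prod.mk.injEq, and_iff_right_iff_imp]
      exact h ω ω' h0 h'

/-- The chain rule. -/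
theorem cEnt_pair (μ : PMF Ω) (A : Ω → α) (B : Ω → β) (C : Ω → γ) :
    cEnt μ (pair A B) C = cEnt μ B C + cEnt μ A (pair B C) := by
  rw [cEnt, cEnt, cEnt, ← ENNReal.tsum_add]
  refine tsum_congr fun ω => ?_
  by_cases h0 : μ ω = 0
  · simp [h0]
  · rw [← mul_add, ← ENNReal.ofReal_add (sub_nonneg.2 (logProb_pair_le _ _ h0))
      (sub_nonneg.2 (logProb_pair_le _ _ h0)),
      logProb_congr (T := pair (pair A B) C) (T' := pair A (pair B C))]
    · congr 2
      ring
    · intro ω' _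
      simp [and_assoc]

theorem ent_pair (μ : PMF Ω) (A : Ω → α) (B : Ω → β) :
    ent μ (pair A B) = ent μ B + cEnt μ A B := by
  rw [ent, cEnt_pair]
  congr 1
  exact cEnt_congr (by simp) (by simp)

/-- Gibbs' inequality. -/
theorem expect_le_of_expect_exp_le {μ : PMF Ω} {f g : Ω → ℝ} (hg : ∀ ω, μ ω ≠ 0 → 0 ≤ g ω)
    (hf : ∀ ω, μ ω ≠ 0 → 0 ≤ f ω)
    (h : ∑' ω, μ ω * ENNReal.ofReal (Real.exp (g ω - f ω)) ≤ 1) :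
    ∑' ω, μ ω * ENNReal.ofReal (g ω) ≤ ∑' ω, μ ω * ENNReal.ofReal (f ω) := by
  -- The expectations may be infinite, so nothing is subtracted: the pointwise inequality g + 1 ≤ f
  -- + exp (g - f) is integrated and the finite constant 1 is cancelled.
  have key : ∑' ω, μ ω * ENNReal.ofReal (g ω) + 1 ≤ ∑' ω, μ ω * ENNReal.ofReal (f ω) + 1 := by
    calc ∑' ω, μ ω * ENNReal.ofReal (g ω) + 1
        = ∑' ω, μ ω * (ENNReal.ofReal (g ω) + 1) := by
          simp only [mul_add, mul_one]
          rw [ENNReal.tsum_add, μ.tsum_coe]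
      _ ≤ ∑' ω, μ ω * (ENNReal.ofReal (f ω) + ENNReal.ofReal (Real.exp (g ω - f ω))) := by
          refine expect_mono fun ω h0 => ?_
          rw [← ENNReal.ofReal_one, ← ENNReal.ofReal_add (hg ω h0) zero_le_one,
            ← ENNReal.ofReal_add (hf ω h0) (Real.exp_pos _).le]
          refine ENNReal.ofReal_le_ofReal ?_
          linarith [Real.add_one_le_exp (g ω - f ω)]
      _ ≤ ∑' ω, μ ω * ENNReal.ofReal (f ω) + 1 := by
          simp only [mul_add]
          rw [ENNReal.tsum_add]
          gcongr
  exact (ENNReal.add_le_add_iff_right ENNReal.one_ne_top).1 key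

theorem ofReal_exp_logProb {μ : PMF Ω} (T : Ω → α) {ω : Ω} (h0 : μ ω ≠ 0) :
    ENNReal.ofReal (Real.exp (logProb μ T ω)) = fiberProb μ T ω := by
  rw [logProb, Real.exp_log (ENNReal.toReal_pos (fiberProb_ne_zero T h0) (fiberProb_ne_top _ _ _)),
    ENNReal.ofReal_toReal (fiberProb_ne_top _ _ _)]

theorem ofReal_exp_neg_logProb {μ : PMF Ω} (T : Ω → α) {ω : Ω} (h0 : μ ω ≠ 0) :
    ENNReal.ofReal (Real.exp (-logProb μ T ω)) = (fiberProb μ T ω)⁻¹ := by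
  rw [Real.exp_neg, ENNReal.ofReal_inv_of_pos (Real.exp_pos _), ofReal_exp_logProb T h0]

theorem tsum_map_pair (μ : PMF Ω) (A : Ω → α) (B : Ω → β) (b : β) :
    ∑' a, μ.map (pair A B) (a, b) = μ.map B b := by
  classical
  simp only [PMF.map_apply]
  rw [ENNReal.tsum_comm]
  refine tsum_congr fun ω => ?_
  rw [tsum_eq_single (A ω)]
  · simp
  · intro a ha
    simp [ha]

/-- If a factor `r` is a subprobability kernel from the values of `B` to the values of `A`, then
`r (A ∣ B) / p (A ∣ B)` has expectation at most one. -/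
theorem expect_kernel_ratio_le (μ : PMF Ω) (A : Ω → α) (B : Ω → β) (r : α → β → ℝ≥0∞)
    (hr : ∀ b, ∑' a, r a b ≤ 1) :
    ∑' ω, μ ω * (r (A ω) (B ω) * fiberProb μ B ω * (fiberProb μ (pair A B) ω)⁻¹) ≤ 1 := by
  have h1 : ∑' ω, μ ω * (r (A ω) (B ω) * fiberProb μ B ω * (fiberProb μ (pair A B) ω)⁻¹) =
      ∑' c : α × β, μ.map (pair A B) c * (r c.1 c.2 * μ.map B c.2 * (μ.map (pair A B) c)⁻¹) :=
    (tsum_map_mul μ (pair A B)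
      fun c => r c.1 c.2 * μ.map B c.2 * (μ.map (pair A B) c)⁻¹).symm
  rw [h1]
  calc _ ≤ ∑' c : α × β, r c.1 c.2 * μ.map B c.2 := by
        refine ENNReal.tsum_le_tsum fun c => ?_
        rw [mul_comm, mul_assoc]
        refine mul_le_of_le_one_right' ?_
        rw [mul_comm]
        exact ENNReal.mul_inv_le_one _
    _ = ∑' b, (∑' a, r a b) * μ.map B b := by
        rw [ENNReal.tsum_prod', ENNReal.tsum_comm]
        simp only [ENNReal.tsum_mul_right]
    _ ≤ ∑' b, μ.map B b := by
        refine ENNReal.tsum_le_tsum fun b => ?_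
        exact mul_le_of_le_one_left' (hr b)
    _ = 1 := PMF.tsum_coe _

/-- The kernel is r(a | b, c) = p(a, c) / p(c). Through Gibbs' inequality this is the nonnegativity
of I(A; B | C), in a form that also serves when entropies are infinite. -/
theorem expect_product_ratio_le (μ : PMF Ω) (A : Ω → α) (B : Ω → β) (C : Ω → γ) :
    ∑' ω, μ ω * ENNReal.ofReal (Real.exp (logProb μ (pair A C) ω + logProb μ (pair B C) ω -
      logProb μ C ω - logProb μ (pair A (pair B C)) ω)) ≤ 1 := by
  refine le_trans (le_of_eq ?_) (expect_kernel_ratio_le μ A (pair B C)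
    (fun a bc => μ.map (pair A C) (a, bc.2) * (μ.map C bc.2)⁻¹) fun bc => ?_)
  · refine expect_congr fun ω h0 => ?_
    rw [sub_eq_add_neg, sub_eq_add_neg, Real.exp_add, Real.exp_add, Real.exp_add,
      ENNReal.ofReal_mul (by positivity), ENNReal.ofReal_mul (by positivity),
      ENNReal.ofReal_mul (by positivity), ofReal_exp_logProb _ h0, ofReal_exp_logProb _ h0,
      ofReal_exp_neg_logProb _ h0, ofReal_exp_neg_logProb _ h0]
    simp only [fiberProb]
    ring
  · rw [ENNReal.tsum_mul_right, tsum_map_pair]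
    exact ENNReal.mul_inv_le_one _

/-- Conditioning reduces entropy. -/
theorem cEnt_pair_right_le (μ : PMF Ω) (A : Ω → α) (B : Ω → β) (C : Ω → γ) :
    cEnt μ A (pair B C) ≤ cEnt μ A C := by
  refine expect_le_of_expect_exp_le (fun ω h0 => sub_nonneg.2 (logProb_pair_le _ _ h0))
    (fun ω h0 => sub_nonneg.2 (logProb_pair_le _ _ h0)) ?_
  refine le_trans (le_of_eq ?_) (expect_product_ratio_le μ A B C)
  refine tsum_congr fun ω => ?_
  congr 3
  ring

/-- A conditional entropy given less information is larger. -/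
theorem cEnt_mono_right {μ : PMF Ω} (A : Ω → α) {B : Ω → β} {C : Ω → γ}
    (h : ∀ ω ω', μ ω ≠ 0 → μ ω' ≠ 0 → B ω' = B ω → C ω' = C ω) : cEnt μ A B ≤ cEnt μ A C := by
  refine le_trans (le_of_eq ?_) (cEnt_pair_right_le μ A B C)
  refine cEnt_congr ?_ ?_
  · intro ω ω' h0 h'
    simpa using h ω ω' h0 h'
  · intro ω ω' h0 h'
    have := h ω ω' h0 h'
    simp only [Prod.mk.injEq]
    tauto

theorem cEnt_le_ent (μ : PMF Ω) (A : Ω → α) (B : Ω → β) : cEnt μ A B ≤ ent μ A :=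
  cEnt_mono_right A (by simp)

theorem CondIndep.logProb_eq {μ : PMF Ω} {A : Ω → α} {B : Ω → β} {C : Ω → γ}
    (h : CondIndep μ A B C) {ω : Ω} (h0 : μ ω ≠ 0) :
    logProb μ (pair A (pair B C)) ω + logProb μ C ω =
      logProb μ (pair A C) ω + logProb μ (pair B C) ω := by
  have h1 := congrArg (fun p => Real.log p.toReal) (h ω h0)
  have hp : ∀ {τ : Type} (T : Ω → τ), (fiberProb μ T ω).toReal ≠ 0 := fun T =>
    (ENNReal.toReal_pos (fiberProb_ne_zero T h0) (fiberProb_ne_top _ _ _)).ne'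
  simp only [ENNReal.toReal_mul] at h1
  rwa [Real.log_mul (hp _) (hp _), Real.log_mul (hp _) (hp _)] at h1

theorem CondIndep.cEnt_eq {μ : PMF Ω} {A : Ω → α} {B : Ω → β} {C : Ω → γ}
    (h : CondIndep μ A B C) : cEnt μ A (pair B C) = cEnt μ A C := by
  refine expect_congr fun ω h0 => ?_
  have := h.logProb_eq h0
  congr 1
  linarith

/-- If `B` and `C` are independent given `(A, D)`, then `I(A; C ∣ B, D) ≤ I(A; C ∣ D)`. -/
theorem CondIndep.submodular {μ : PMF Ω} {A : Ω → α} {B : Ω → β} {C : Ω → γ} {D : Ω → δ}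
    (h : CondIndep μ B C (pair A D)) :
    cEnt μ A (pair B D) + cEnt μ A (pair C D) ≤ cEnt μ A D + cEnt μ A (pair B (pair C D)) := by
  have hsum : ∀ {τ τ' : Type} (T : Ω → τ) (T' : Ω → τ'), cEnt μ A T + cEnt μ A T' =
      ∑' ω, μ ω * ENNReal.ofReal ((logProb μ T ω - logProb μ (pair A T) ω) +
        (logProb μ T' ω - logProb μ (pair A T') ω)) := by
    intro τ τ' T T'
    rw [cEnt, cEnt, ← ENNReal.tsum_add]
    refine (tsum_congr fun ω => ?_)
    by_cases h0 : μ ω = 0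
    · simp [h0]
    · rw [← mul_add, ← ENNReal.ofReal_add (sub_nonneg.2 (logProb_pair_le _ _ h0))
        (sub_nonneg.2 (logProb_pair_le _ _ h0))]
  have hnn : ∀ {τ τ' : Type} (T : Ω → τ) (T' : Ω → τ') (ω : Ω), μ ω ≠ 0 →
      0 ≤ (logProb μ T ω - logProb μ (pair A T) ω) +
        (logProb μ T' ω - logProb μ (pair A T') ω) := fun T T' ω h0 =>
    add_nonneg (sub_nonneg.2 (logProb_pair_le _ _ h0)) (sub_nonneg.2 (logProb_pair_le _ _ h0))
  rw [hsum, hsum]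
  refine expect_le_of_expect_exp_le (hnn _ _) (hnn _ _) ?_
  -- Formally the difference of the two sides is I(B; C | D) - I(B; C | A, D). The hypothesis makes
  -- the density of the second term vanish pointwise, so only the density of I(B; C | D) remains in
  -- the exponent.
  refine le_trans (le_of_eq ?_) (expect_product_ratio_le μ B C D)
  refine expect_congr fun ω h0 => ?_
  have h1 := h.logProb_eq h0
  rw [logProb_congr (T := pair B (pair C (pair A D))) (T' := pair A (pair B (pair C D))),
    logProb_congr (T := pair B (pair A D)) (T' := pair A (pair B D)),
    logProb_congr (T := pair C (pair A D)) (T' := pair A (pair C D))] at h1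
  · congr 2
    linarith
  all_goals
    intro ω' _
    simp only [Prod.mk.injEq]
    tauto

/-- A form of Fano's inequality: the conditional entropy of a quantity with finitely many values
vanishes in the limit if, almost surely, it is eventually guessed correctly. -/
theorem tendsto_cEnt_of_eventually_guess [Fintype α] [DecidableEq α] (μ : PMF Ω) (F : Ω → α)
    (T : ℕ → Ω → β) (g : ℕ → β → α)
    (h : ∀ ω, μ ω ≠ 0 → ∀ᶠ t in Filter.atTop, g t (T t ω) = F ω) :
    Filter.Tendsto (fun t => cEnt μ F (T t)) Filter.atTop (nhds 0) := by
  -- One more than the number of values, so that N is positive without any nonemptiness assumption.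
  set N : ℝ := Fintype.card α + 1 with hN
  have hNpos : 0 < N := by positivity
  -- the probability of a wrong guess vanishes in the limit
  have herr : Filter.Tendsto (fun t => ∑' ω, μ ω * if g t (T t ω) = F ω then 0 else 1)
      Filter.atTop (nhds 0) := by
    have h1 : Filter.Tendsto (fun t => ∑' ω, (μ ω * if g t (T t ω) = F ω then 0 else 1).toReal)
        Filter.atTop (nhds (∑' _ : Ω, (0 : ℝ))) := by
      refine tendsto_tsum_of_dominated_convergence (bound := fun ω => (μ ω).toReal)
        (ENNReal.summable_toReal (by simp [μ.tsum_coe])) ?_ ?_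
      · intro ω
        by_cases h0 : μ ω = 0
        · simp [h0]
        · refine tendsto_const_nhds.congr' ?_
          filter_upwards [h ω h0] with t ht
          simp [ht]
      · refine Filter.Eventually.of_forall fun t ω => ?_
        split_ifs <;> simp
    rw [tsum_zero] at h1
    have h2 := ENNReal.tendsto_ofReal h1
    rw [ENNReal.ofReal_zero] at h2
    refine h2.congr fun t => ?_
    have hle : ∀ ω, (μ ω * if g t (T t ω) = F ω then 0 else 1) ≤ μ ω := by
      intro ω
      split_ifs <;> simp
    have hfin : ∑' ω, (μ ω * if g t (T t ω) = F ω then 0 else 1) ≠ ∞ :=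
      ne_top_of_le_ne_top ENNReal.one_ne_top
        ((ENNReal.tsum_le_tsum hle).trans μ.tsum_coe.le)
    rw [← ENNReal.tsum_toReal_eq, ENNReal.ofReal_toReal hfin]
    exact fun ω => ne_top_of_le_ne_top (μ.apply_ne_top ω) (hle ω)
  -- the entropy is bounded in terms of that probability
  have hbound : ∀ δ : ℝ, 0 < δ → δ < 1 → ∀ t, cEnt μ F (T t) ≤
      ENNReal.ofReal (-Real.log (1 - δ)) + ENNReal.ofReal (-Real.log (δ / N)) *
        ∑' ω, μ ω * if g t (T t ω) = F ω then 0 else 1 := by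
    intro δ hδ hδ1 t
    have hdN : δ / N < 1 := by
      rw [div_lt_one hNpos]
      have : (1 : ℝ) ≤ N := by simp [hN]
      linarith
    have hdN0 : 0 < δ / N := by positivity
    set f : Ω → ℝ := fun ω =>
      if g t (T t ω) = F ω then -Real.log (1 - δ) else -Real.log (δ / N) with hf
    have hfnn : ∀ ω, 0 ≤ f ω := by
      intro ω
      simp only [hf]
      split_ifs
      · exact neg_nonneg.2 (Real.log_nonpos (by linarith) (by linarith))
      · exact neg_nonneg.2 (Real.log_nonpos hdN0.le hdN.le)
    have hle : cEnt μ F (T t) ≤ ∑' ω, μ ω * ENNReal.ofReal (f ω) := by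
      refine expect_le_of_expect_exp_le (fun ω h0 => sub_nonneg.2 (logProb_pair_le _ _ h0))
        (fun ω _ => hfnn ω) ?_
      -- Gibbs' inequality against the kernel that gives weight 1 - δ to the guess and δ / N to
      -- every other value.
      refine le_trans (le_of_eq ?_) (expect_kernel_ratio_le μ F (T t)
        (fun a b => ENNReal.ofReal (if g t b = a then 1 - δ else δ / N)) fun b => ?_)
      · refine expect_congr fun ω h0 => ?_
        have hexp : Real.exp (-f ω) = if g t (T t ω) = F ω then 1 - δ else δ / N := by
          simp only [hf]
          split_ifs
          · rw [neg_neg, Real.exp_log (by linarith)]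
          · rw [neg_neg, Real.exp_log hdN0]
        rw [← hexp, ← ofReal_exp_logProb _ h0, ← ofReal_exp_neg_logProb _ h0,
          ← ENNReal.ofReal_mul (by positivity), ← ENNReal.ofReal_mul (by positivity),
          ← Real.exp_add, ← Real.exp_add]
        congr 2
        ring
      · rw [tsum_fintype, ← ENNReal.ofReal_sum_of_nonneg]
        · rw [← ENNReal.ofReal_one]
          refine ENNReal.ofReal_le_ofReal ?_
          calc ∑ a, (if g t b = a then 1 - δ else δ / N)
              ≤ ∑ a, ((if g t b = a then 1 - δ else 0) + δ / N) := by
                refine Finset.sum_le_sum fun a _ => ?_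
                split_ifs <;> linarith
            _ = (1 - δ) + (N - 1) * (δ / N) := by
                rw [Finset.sum_add_distrib, Finset.sum_ite_eq]
                simp [hN]
            _ ≤ 1 := by
                have : N * (δ / N) = δ := by field_simp
                nlinarith
        · intro a _
          split_ifs <;> linarith
    refine hle.trans ?_
    rw [← ENNReal.tsum_mul_left]
    calc _ ≤ ∑' ω, (μ ω * ENNReal.ofReal (-Real.log (1 - δ)) + ENNReal.ofReal (-Real.log (δ / N)) *
          (μ ω * if g t (T t ω) = F ω then 0 else 1)) := by
          refine ENNReal.tsum_le_tsum fun ω => ?_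
          simp only [hf]
          split_ifs
          · simp
          · rw [mul_one, mul_comm (ENNReal.ofReal (-Real.log (δ / N)))]
            exact le_add_self
      _ = _ := by rw [ENNReal.tsum_add, expect_const]
  rw [ENNReal.tendsto_nhds_zero]
  intro ε hε
  obtain ⟨ε', hε'0, hε'⟩ : ∃ ε' : ℝ, 0 < ε' ∧ ENNReal.ofReal ε' ≤ ε := by
    obtain ⟨r, hr0, hr⟩ := ENNReal.lt_iff_exists_real_btwn.1 hε
    exact ⟨r, ENNReal.ofReal_pos.1 hr.1, hr.2.le⟩
  -- Chosen so that the contribution -log (1 - δ) of the correct guesses is exactly ε' / 2.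
  set δ : ℝ := 1 - Real.exp (-(ε' / 2)) with hδ
  have hexp1 : Real.exp (-(ε' / 2)) < 1 := by rw [← Real.exp_zero]; exact Real.exp_lt_exp.2 (by linarith)
  have hδ0 : 0 < δ := by linarith
  have hδ1 : δ < 1 := by
    have := Real.exp_pos (-(ε' / 2))
    linarith
  have hlog : -Real.log (1 - δ) = ε' / 2 := by
    rw [hδ, sub_sub_cancel, Real.log_exp, neg_neg]
  have hlim := ENNReal.Tendsto.const_mul (a := ENNReal.ofReal (-Real.log (δ / N))) herr
    (Or.inr ENNReal.ofReal_ne_top)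
  rw [mul_zero, ENNReal.tendsto_nhds_zero] at hlim
  filter_upwards [hlim (ENNReal.ofReal (ε' / 2)) (ENNReal.ofReal_pos.2 (by linarith))] with t ht
  calc cEnt μ F (T t) ≤ _ := hbound δ hδ0 hδ1 t
    _ ≤ ENNReal.ofReal (ε' / 2) + ENNReal.ofReal (ε' / 2) := by
        rw [hlog]
        gcongr
    _ = ENNReal.ofReal ε' := by
        rw [← ENNReal.ofReal_add (by linarith) (by linarith)]
        congr 1
        ring
    _ ≤ ε := hε'

/-- The joint law of a random variable `ω` with law `μ` and of a variable that is drawn, with fresh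
randomness, from a distribution depending on `ω`. -/
@[irreducible]
def extend (μ : PMF Ω) (κ : Ω → PMF Ω') : PMF (Ω × Ω') := μ.bind fun ω => (κ ω).map (Prod.mk ω)

theorem extend_apply (μ : PMF Ω) (κ : Ω → PMF Ω') (p : Ω × Ω') :
    extend μ κ p = μ p.1 * κ p.1 p.2 := by
  classical
  rw [extend, PMF.bind_apply, tsum_eq_single p.1]
  · rw [PMF.map_apply, tsum_eq_single p.2]
    · simp
    · intro a ha
      rw [if_neg]
      rintro h
      exact ha (congrArg Prod.snd h).symm
  · intro ω hω
    rw [PMF.map_apply, ENNReal.tsum_eq_zero.2, mul_zero]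
    intro a
    rw [if_neg]
    rintro h
    exact hω (congrArg Prod.fst h).symm

theorem extend_ne_zero {μ : PMF Ω} {κ : Ω → PMF Ω'} {p : Ω × Ω'} :
    extend μ κ p ≠ 0 ↔ μ p.1 ≠ 0 ∧ κ p.1 p.2 ≠ 0 := by
  rw [extend_apply, mul_ne_zero_iff]

theorem extend_map_fst (μ : PMF Ω) (κ : Ω → PMF Ω') : (extend μ κ).map Prod.fst = μ := by
  rw [extend, PMF.map_bind]
  conv_rhs => rw [← PMF.bind_pure μ]
  congr 1
  funext ω
  rw [PMF.map_comp]
  exact PMF.map_const _ _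

theorem expect_extend_fst (μ : PMF Ω) (κ : Ω → PMF Ω') (f : Ω → ℝ≥0∞) :
    ∑' p, extend μ κ p * f p.1 = ∑' ω, μ ω * f ω := by
  rw [← tsum_map_mul (extend μ κ) Prod.fst f, extend_map_fst]

theorem cEnt_extend_fst (μ : PMF Ω) (κ : Ω → PMF Ω') (A : Ω → α) (B : Ω → β) :
    cEnt (extend μ κ) (fun p => A p.1) (fun p => B p.1) = cEnt μ A B := by
  conv_rhs => rw [← extend_map_fst μ κ, cEnt_map]
  rfl

theorem fiberProb_extend_fst (μ : PMF Ω) (κ : Ω → PMF Ω') (A : Ω → α) (p : Ω × Ω') :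
    fiberProb (extend μ κ) (fun p => A p.1) p = fiberProb μ A p.1 := by
  conv_rhs => rw [← extend_map_fst μ κ, fiberProb_map]
  rfl

/-- If the law of `F` depends only on `G`, then fibre probabilities factor. -/
theorem fiberProb_extend {μ : PMF Ω} {κ : Ω → PMF Ω'} {F : Ω' → α} {G : Ω → β} {p : Ω × Ω'}
    (h : ∀ ω, μ ω ≠ 0 → G ω = G p.1 → (κ ω).map F = (κ p.1).map F) :
    fiberProb (extend μ κ) (fun q => (F q.2, G q.1)) p =
      fiberProb μ G p.1 * (κ p.1).map F (F p.2) := by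
  classical
  rw [fiberProb_eq_tsum, fiberProb_eq_tsum, ← ENNReal.tsum_mul_right, ENNReal.tsum_prod']
  refine tsum_congr fun ω => ?_
  by_cases h0 : μ ω = 0
  · simp [extend_apply, h0]
  by_cases hG : G ω = G p.1
  · rw [if_pos hG, ← h ω h0 hG, PMF.map_apply, ← ENNReal.tsum_mul_left]
    refine tsum_congr fun a => ?_
    simp only [extend_apply, Prod.mk.injEq, hG, and_true, eq_comm (a := F p.2), mul_ite, mul_zero]
  · simp [hG]

end InformationCalculus

/-! ### Interaction information along a protocol -/

section Interaction

variable {Ω Ω' A B α β γ : Type}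

/-- `I(U; V ∣ W) ≤ I(U; V)`, written without subtraction. -/
def InteractionNonneg (μ : PMF Ω) (U : Ω → α) (V : Ω → β) (W : Ω → γ) : Prop :=
  cEnt μ U V + cEnt μ U W ≤ ent μ U + cEnt μ U (pair V W)

theorem InteractionNonneg.swap {μ : PMF Ω} {U : Ω → α} {V : Ω → β} {W : Ω → γ}
    (h : InteractionNonneg μ U V W) : InteractionNonneg μ U W V := by
  have h1 : cEnt μ U (pair W V) = cEnt μ U (pair V W) :=
    cEnt_congr (by simp [and_comm]) (by simp [and_comm])
  rw [InteractionNonneg, add_comm, h1]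
  exact h

theorem InteractionNonneg.congr {α' β' γ' : Type} {μ : PMF Ω} {U : Ω → α} {V : Ω → β} {W : Ω → γ}
    {U' : Ω → α'} {V' : Ω → β'} {W' : Ω → γ'} (h : InteractionNonneg μ U V W)
    (hU : ∀ ω ω', U ω' = U ω ↔ U' ω' = U' ω) (hV : ∀ ω ω', V ω' = V ω ↔ V' ω' = V' ω)
    (hW : ∀ ω ω', W ω' = W ω ↔ W' ω' = W' ω) : InteractionNonneg μ U' V' W' := by
  have h1 : cEnt μ U V = cEnt μ U' V' := cEnt_congr (by simp [hV]) (by simp [hU, hV])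
  have h2 : cEnt μ U W = cEnt μ U' W' := cEnt_congr (by simp [hW]) (by simp [hU, hW])
  have h3 : ent μ U = ent μ U' := cEnt_congr (by simp) (by simp [hU])
  have h4 : cEnt μ U (pair V W) = cEnt μ U' (pair V' W') :=
    cEnt_congr (by simp [hV, hW]) (by simp [hU, hV, hW])
  rw [InteractionNonneg, ← h1, ← h2, ← h3, ← h4]
  exact h

theorem InteractionNonneg.map {μ : PMF Ω} (f : Ω → Ω') {U : Ω' → α} {V : Ω' → β} {W : Ω' → γ}
    (h : InteractionNonneg μ (U ∘ f) (V ∘ f) (W ∘ f)) : InteractionNonneg (μ.map f) U V W := by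
  rw [InteractionNonneg, cEnt_map, cEnt_map, cEnt_map, ent_map]
  exact h

theorem InteractionNonneg.of_map {μ : PMF Ω} (f : Ω → Ω') {U : Ω' → α} {V : Ω' → β} {W : Ω' → γ}
    (h : InteractionNonneg (μ.map f) U V W) : InteractionNonneg μ (U ∘ f) (V ∘ f) (W ∘ f) := by
  rw [InteractionNonneg, cEnt_map, cEnt_map, cEnt_map, ent_map] at h
  exact h

/-- The inequality reads I(U; W | V) ≤ I(U; W). Adding b to V does not increase the left side, by
submodularity, as b is independent of W given (U, V). Adding a to U leaves the left side unchanged,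
because a carries nothing about W given (b, U, V), and can only increase the right side. Finiteness
of the entropy of U permits the cancellation. -/
theorem InteractionNonneg.pair_left {μ : PMF Ω} {U : Ω → α} {V : Ω → β} {W : Ω → γ}
    {a : Ω → A} {b : Ω → B} (h : InteractionNonneg μ U V W) (hfin : ent μ U ≠ ∞)
    (ha : CondIndep μ a W (pair b (pair U V))) (hb : CondIndep μ b W (pair U V)) :
    InteractionNonneg μ (pair a U) (pair b V) W := by
  have h1 : cEnt μ a (pair U (pair (pair b V) W)) = cEnt μ a (pair U (pair b V)) := by
    rw [cEnt_congr (T' := a) (C' := pair W (pair b (pair U V))), ha.cEnt_eq]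
    · exact cEnt_congr (by simp; tauto) (by simp; tauto)
    · simp; tauto
    · simp; tauto
  have h2 : cEnt μ U (pair (pair b V) W) = cEnt μ U (pair b (pair W V)) :=
    cEnt_congr (by simp; tauto) (by simp; tauto)
  have h3 : cEnt μ U (pair W V) = cEnt μ U (pair V W) :=
    cEnt_congr (by simp; tauto) (by simp; tauto)
  have h4 : cEnt μ a (pair U W) ≤ cEnt μ a U := cEnt_mono_right a (by simp; tauto)
  have h5 := hb.submodular
  have h6 : cEnt μ U (pair b V) + cEnt μ U W ≤ ent μ U + cEnt μ U (pair b (pair W V)) := by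
    have hlt : cEnt μ U V + cEnt μ U (pair W V) ≠ ∞ :=
      ENNReal.add_ne_top.2 ⟨ne_top_of_le_ne_top hfin (cEnt_le_ent _ _ _),
        ne_top_of_le_ne_top hfin (cEnt_le_ent _ _ _)⟩
    rw [← ENNReal.add_le_add_iff_right hlt]
    calc _ = (cEnt μ U (pair b V) + cEnt μ U (pair W V)) + (cEnt μ U V + cEnt μ U W) := by ring
      _ ≤ (cEnt μ U V + cEnt μ U (pair b (pair W V))) + (ent μ U + cEnt μ U (pair V W)) :=
          add_le_add h5 h
      _ = _ := by rw [h3]; ring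
  rw [InteractionNonneg, cEnt_pair, cEnt_pair, cEnt_pair, ent_pair, h1, h2]
  calc _ = (cEnt μ U (pair b V) + cEnt μ U W) +
        (cEnt μ a (pair U W) + cEnt μ a (pair U (pair b V))) := by ring
    _ ≤ (ent μ U + cEnt μ U (pair b (pair W V))) +
        (cEnt μ a U + cEnt μ a (pair U (pair b V))) := add_le_add h6 (by gcongr)
    _ = _ := by ring

theorem condIndep_extend {μ : PMF Ω} {κ : Ω → PMF Ω'} (F : Ω' → α) (C : Ω → β) {D : Ω → γ}
    (hκ : ∀ ω ω', μ ω ≠ 0 → μ ω' ≠ 0 → D ω' = D ω → (κ ω').map F = (κ ω).map F) :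
    CondIndep (extend μ κ) (fun p => F p.2) (fun p => C p.1) (fun p => D p.1) := by
  intro p hp
  have hp1 := (extend_ne_zero.1 hp).1
  have h1 : fiberProb (extend μ κ) (pair (fun p => F p.2) (pair (fun p => C p.1) fun p => D p.1)) p
      = fiberProb μ (pair C D) p.1 * (κ p.1).map F (F p.2) :=
    fiberProb_extend (G := pair C D) fun ω h0 h => hκ _ _ hp1 h0 (Prod.mk.inj h).2
  have h2 : fiberProb (extend μ κ) (pair (fun p => F p.2) fun p => D p.1) p
      = fiberProb μ D p.1 * (κ p.1).map F (F p.2) :=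
    fiberProb_extend (G := D) fun ω h0 h => hκ _ _ hp1 h0 h
  have h3 : fiberProb (extend μ κ) (pair (fun p => C p.1) fun p => D p.1) p
      = fiberProb μ (pair C D) p.1 := fiberProb_extend_fst μ κ (pair C D) p
  rw [h1, h2, h3, fiberProb_extend_fst]
  ring

/-- A party may correlate its messages on its two links. The message on one link must therefore be
handled conditionally on the one sent simultaneously on the other. -/
theorem condIndep_extend' {μ : PMF Ω} {κ : Ω → PMF Ω'} (E : Ω' → A) (F : Ω' → α) (C : Ω → β)
    {D : Ω → γ}
    (hκ : ∀ ω ω', μ ω ≠ 0 → μ ω' ≠ 0 → D ω' = D ω →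
      (κ ω').map (pair E F) = (κ ω).map (pair E F)) :
    CondIndep (extend μ κ) (fun p => E p.2) (fun p => C p.1)
      (fun p => (F p.2, D p.1)) := by
  have hκ' : ∀ ω ω', μ ω ≠ 0 → μ ω' ≠ 0 → D ω' = D ω → (κ ω').map F = (κ ω).map F := by
    intro ω ω' h0 h1 h
    have := congrArg (PMF.map Prod.snd) (hκ ω ω' h0 h1 h)
    rwa [PMF.map_comp, PMF.map_comp] at this
  intro p hp
  have hp1 := (extend_ne_zero.1 hp).1
  have h1 : fiberProb (extend μ κ)
      (pair (fun p => E p.2) (pair (fun p => C p.1) fun p => (F p.2, D p.1))) p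
      = fiberProb μ (pair C D) p.1 * (κ p.1).map (pair E F) (pair E F p.2) :=
    (fiberProb_congr (by simp; tauto)).trans (fiberProb_extend (F := pair E F) (G := pair C D)
      fun ω h0 h => hκ p.1 ω hp1 h0 (Prod.mk.inj h).2)
  have h2 : fiberProb (extend μ κ) (fun p => (F p.2, D p.1)) p
      = fiberProb μ D p.1 * (κ p.1).map F (F p.2) :=
    fiberProb_extend (G := D) fun ω h0 h => hκ' p.1 ω hp1 h0 h
  have h3 : fiberProb (extend μ κ) (pair (fun p => E p.2) fun p => (F p.2, D p.1)) p
      = fiberProb μ D p.1 * (κ p.1).map (pair E F) (pair E F p.2) :=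
    (fiberProb_congr (by simp; tauto)).trans (fiberProb_extend (F := pair E F) (G := D)
      fun ω h0 h => hκ p.1 ω hp1 h0 h)
  have h4 : fiberProb (extend μ κ) (pair (fun p => C p.1) fun p => (F p.2, D p.1)) p
      = fiberProb μ (pair C D) p.1 * (κ p.1).map F (F p.2) :=
    (fiberProb_congr (by simp; tauto)).trans (fiberProb_extend (F := F) (G := pair C D)
      fun ω h0 h => hκ' p.1 ω hp1 h0 (Prod.mk.inj h).2)
  rw [h1, h2, h3, h4]
  ring

theorem ent_extend_fst (μ : PMF Ω) (κ : Ω → PMF Ω') (U : Ω → α) :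
    ent (extend μ κ) (fun p => U p.1) = ent μ U := cEnt_extend_fst μ κ U fun _ => ()

theorem InteractionNonneg.extend_fst {μ : PMF Ω} {U : Ω → α} {V : Ω → β} {W : Ω → γ}
    (h : InteractionNonneg μ U V W) (κ : Ω → PMF Ω') :
    InteractionNonneg (extend μ κ) (fun p => U p.1) (fun p => V p.1) (fun p => W p.1) := by
  have h2 : cEnt (extend μ κ) (fun p => U p.1) (pair (fun p => V p.1) fun p => W p.1) =
      cEnt μ U (pair V W) := cEnt_extend_fst μ κ U (pair V W)
  rw [InteractionNonneg, cEnt_extend_fst, cEnt_extend_fst, ent_extend_fst, h2]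
  exact h

/-- A party that sees `U` and `V` sends messages over the corresponding links. -/
theorem InteractionNonneg.extend_left {μ : PMF Ω} {U : Ω → α} {V : Ω → β} {W : Ω → γ}
    {κ : Ω → PMF (A × B)} (h : InteractionNonneg μ U V W) (hfin : ent μ U ≠ ∞)
    (hκ : ∀ ω ω', U ω' = U ω → V ω' = V ω → κ ω' = κ ω) :
    InteractionNonneg (extend μ κ) (fun p => (p.2.1, U p.1)) (fun p => (p.2.2, V p.1))
      (fun p => W p.1) := by
  have hfin' : ent (extend μ κ) (fun p => U p.1) ≠ ∞ := by
    rwa [ent_extend_fst]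
  have hκ' : ∀ ω ω', μ ω ≠ 0 → μ ω' ≠ 0 → pair U V ω' = pair U V ω → κ ω' = κ ω :=
    fun ω ω' _ _ hD => hκ ω ω' (Prod.mk.inj hD).1 (Prod.mk.inj hD).2
  have ha := condIndep_extend' (μ := μ) (κ := κ) (D := pair U V) Prod.fst Prod.snd W
    fun ω ω' h0 h1 hD => by rw [hκ' ω ω' h0 h1 hD]
  have hb := condIndep_extend (μ := μ) (κ := κ) (D := pair U V) Prod.snd W
    fun ω ω' h0 h1 hD => by rw [hκ' ω ω' h0 h1 hD]
  exact InteractionNonneg.pair_left (a := fun p : Ω × A × B => p.2.1)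
    (b := fun p : Ω × A × B => p.2.2) (h.extend_fst κ) hfin' ha hb

theorem CondIndep.symm {μ : PMF Ω} {U : Ω → α} {V : Ω → β} {W : Ω → γ} (h : CondIndep μ U V W) :
    CondIndep μ V U W := by
  intro ω h0
  rw [fiberProb_congr (T' := pair U (pair V W)) (by simp; tauto), h ω h0, mul_comm]

/-- If the law of `F` depends only on `D`, then `F` contains no information about `U` beyond `D`. -/
theorem cEnt_extend_fst_given {μ : PMF Ω} {κ : Ω → PMF Ω'} (U : Ω → α) (F : Ω' → γ) (D : Ω → β)
    (hκ : ∀ ω ω', μ ω ≠ 0 → μ ω' ≠ 0 → D ω' = D ω → (κ ω').map F = (κ ω).map F) :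
    cEnt (extend μ κ) (fun p => U p.1) (fun p => (F p.2, D p.1)) = cEnt μ U D := by
  rw [← cEnt_extend_fst μ κ U D]
  exact (condIndep_extend F U hκ).symm.cEnt_eq

/-- The party that sees `V` and `W` sends messages over the corresponding links. -/
theorem InteractionNonneg.extend_right {μ : PMF Ω} {U : Ω → α} {V : Ω → β} {W : Ω → γ}
    {κ : Ω → PMF (A × B)} (h : InteractionNonneg μ U V W)
    (hκ : ∀ ω ω', V ω' = V ω → W ω' = W ω → κ ω' = κ ω) :
    InteractionNonneg (extend μ κ) (fun p => U p.1) (fun p => (p.2.1, V p.1))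
      (fun p => (p.2.2, W p.1)) := by
  have h2 : cEnt (extend μ κ) (fun p => U p.1)
      (pair (fun p => (p.2.1, V p.1)) fun p => (p.2.2, W p.1)) = cEnt μ U (pair V W) := by
    -- Given V and W the new messages say nothing about U, so the right side of the inequality is
    -- unchanged; the terms on the left can only drop under the additional conditioning.
    rw [← cEnt_extend_fst_given (κ := κ) U id (pair V W) fun ω ω' _ _ hD => by
      rw [hκ ω ω' (Prod.mk.inj hD).1 (Prod.mk.inj hD).2]]
    refine cEnt_congr ?_ ?_
    · simp only [Prod.ext_iff, id]
      tauto
    · simp only [Prod.ext_iff, id]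
      tauto
  rw [InteractionNonneg, ent_extend_fst, h2]
  refine le_trans (add_le_add ?_ ?_) h
  · rw [← cEnt_extend_fst μ κ U V]
    exact cEnt_pair_right_le _ _ _ _
  · rw [← cEnt_extend_fst μ κ U W]
    exact cEnt_pair_right_le _ _ _ _

end Interaction

/-! ### The interaction inequality along the rounds of a protocol -/

section Run

variable {X Y Z : Type}

/-- The joint law of the inputs and of the history after `t` rounds. -/
def NextMessage.runLaw (P : NextMessage X Y Z) (q : PMF (X × Y)) (t : ℕ) :
    PMF ((X × Y) × History) :=
  extend q fun s => P.run s.1 s.2 t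

/-- One round, played one party after the other. -/
theorem NextMessage.runLaw_succ (P : NextMessage X Y Z) (q : PMF (X × Y)) (t : ℕ) :
    P.runLaw q (t + 1) =
      (extend (extend (extend (P.runLaw q t)
        (fun p => P.alice p.1.1 p.2.l12 p.2.l31))
        (fun p => P.bob p.1.1.2 p.1.2.l12 p.1.2.l23))
        (fun p => P.charlie p.1.1.2.l23 p.1.1.2.l31)).map
      (fun p => (p.1.1.1.1, p.1.1.1.2.append
        ⟨(p.1.1.2.1, p.1.2.1), (p.1.2.2, p.2.2), (p.2.1, p.1.1.2.2)⟩)) := by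
  simp only [NextMessage.runLaw, extend, NextMessage.run, NextMessage.round, PMF.map, PMF.bind_bind,
    PMF.pure_bind, Function.comp_apply]

/-- Placing both inputs on the side of link `12` makes each party's messages a function, up to fresh
randomness, of two of the three variables. Alice extends U and V, Bob extends U and W, Charlie
extends V and W. At time 0 both links to Charlie are empty and equality holds. -/
theorem NextMessage.interactionNonneg_run (P : NextMessage X Y Z) (q : PMF (X × Y))
    (hfin : ∀ t, ent (P.runLaw q t) (fun p => (p.1, p.2.l12)) ≠ ∞) (t : ℕ) :
    InteractionNonneg (P.runLaw q t) (fun p => (p.1, p.2.l12)) (fun p => p.2.l31)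
      (fun p => p.2.l23) := by
  induction t with
  | zero =>
    have hsupp : ∀ p, P.runLaw q 0 p ≠ 0 → p.2 = ⟨[], [], []⟩ := by
      intro p hp
      have := (extend_ne_zero.1 hp).2
      simpa [NextMessage.run] using this
    rw [InteractionNonneg, ent]
    refine le_of_eq ?_
    congr 1 <;> refine cEnt_congr ?_ ?_ <;> intro p p' hp hp' <;>
      simp [hsupp p hp, hsupp p' hp']
  | succ t ih =>
    rw [NextMessage.runLaw_succ]
    refine InteractionNonneg.map _ ?_
    have h1 := ih.extend_left (κ := fun p => P.alice p.1.1 p.2.l12 p.2.l31) (hfin t) (by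
      intro ω ω' hU hV
      simp only [Prod.mk.injEq] at hU hV
      rw [hU.1, hU.2, hV])
    -- Finiteness in the middle of a round: the inputs, the history of link `12` and Alice's new
    -- message are all determined by the inputs and link `12` after the full round.
    have hfin' : ent (extend (P.runLaw q t) fun p => P.alice p.1.1 p.2.l12 p.2.l31)
        (fun p => (p.2.1, (p.1.1, p.1.2.l12))) ≠ ∞ := by
      refine ne_top_of_le_ne_top (hfin (t + 1)) ?_
      rw [NextMessage.runLaw_succ, ent_map]
      rw [← ent_extend_fst (extend (P.runLaw q t) fun p => P.alice p.1.1 p.2.l12 p.2.l31)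
        fun p => P.bob p.1.1.2 p.1.2.l12 p.1.2.l23]
      rw [← ent_extend_fst (extend (extend (P.runLaw q t) fun p => P.alice p.1.1 p.2.l12 p.2.l31)
        fun p => P.bob p.1.1.2 p.1.2.l12 p.1.2.l23) fun p => P.charlie p.1.1.2.l23 p.1.1.2.l31]
      refine cEnt_mono_left ?_
      intro ω ω' _ _ he _
      simp only [Function.comp_apply, History.append, Prod.mk.injEq, List.append_singleton_inj] at he
      simp only [Prod.mk.injEq]
      tauto
    have h3 := h1.swap.extend_left (κ := fun p => P.bob p.1.1.2 p.1.2.l12 p.1.2.l23) hfin' (by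
      intro ω ω' hU hV
      simp only [Prod.mk.injEq] at hU hV
      rw [hU.2.1, hU.2.2, hV])
    have h4 := h3.swap.extend_right (κ := fun p => P.charlie p.1.1.2.l23 p.1.1.2.l31) (by
      intro ω ω' hV hW
      simp only [Prod.mk.injEq] at hV hW
      rw [hV.2, hW.2])
    refine h4.congr ?_ ?_ ?_
    all_goals
      intro ω ω'
      simp only [Function.comp_apply, History.append, Prod.mk.injEq, List.append_singleton_inj]
      tauto

end Run

/-! ### Executions of a protocol -/

section Executions

variable {X Y Z : Type}

/-- Both masses have total 1, so no pointwise inequality can be strict. -/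
theorem PMF.eq_of_le {α : Type} {p q : PMF α} (h : ∀ a, p a ≤ q a) : p = q := by
  refine PMF.ext fun a => le_antisymm (h a) ?_
  by_contra hlt
  have h1 : ∑' b, p b < ∑' b, q b :=
    ENNReal.tsum_lt_tsum (by simp [p.tsum_coe]) h (not_le.1 hlt)
  simp [p.tsum_coe, q.tsum_coe] at h1

theorem PMF.eq_pure_iff {α : Type} {p : PMF α} {a : α} :
    p = PMF.pure a ↔ ∀ b ∈ p.support, b = a := by
  refine ⟨?_, fun h => PMF.eq_of_le fun b => ?_⟩
  · rintro rfl b hb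
    simpa using hb
  · by_cases hb : b ∈ p.support
    · rw [h b hb, PMF.pure_apply_self]
      exact p.coe_le_one a
    · rw [(p.apply_eq_zero_iff b).2 hb]
      exact bot_le

/-- The first `t` rounds of a history. -/
def History.take (t : ℕ) (h : History) : History := ⟨h.l12.take t, h.l23.take t, h.l31.take t⟩

/-- The messages of a silent round. -/
def silentRound : Links Exchange := ⟨([], []), ([], []), ([], [])⟩

namespace NextMessage

variable (N : NextMessage X Y Z)

theorem mem_support_round {x : X} {y : Y} {h : History} {r : Links Exchange} :
    r ∈ (N.round x y h).support ↔ (r.l12.1, r.l31.2) ∈ (N.alice x h.l12 h.l31).support ∧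
      (r.l12.2, r.l23.1) ∈ (N.bob y h.l12 h.l23).support ∧
      (r.l31.1, r.l23.2) ∈ (N.charlie h.l23 h.l31).support := by
  simp only [round, PMF.mem_support_bind_iff, PMF.mem_support_map_iff]
  constructor
  · rintro ⟨a, ha, b, hb, c, hc, rfl⟩
    exact ⟨ha, hb, hc⟩
  · rintro ⟨ha, hb, hc⟩
    exact ⟨_, ha, _, hb, _, hc, rfl⟩

theorem mem_support_run_succ {x : X} {y : Y} {t : ℕ} {h : History} :
    h ∈ (N.run x y (t + 1)).support ↔ ∃ g ∈ (N.run x y t).support,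
      ∃ r ∈ (N.round x y g).support, g.append r = h := by
  simp only [run, PMF.mem_support_bind_iff, PMF.mem_support_map_iff]

theorem length_of_mem_support_run {x : X} {y : Y} {t : ℕ} {h : History}
    (hh : h ∈ (N.run x y t).support) :
    h.l12.length = t ∧ h.l23.length = t ∧ h.l31.length = t := by
  induction t generalizing h with
  | zero =>
    have : h = ⟨[], [], []⟩ := by simpa [run] using hh
    simp [this]
  | succ t ih =>
    obtain ⟨g, hg, r, -, rfl⟩ := N.mem_support_run_succ.1 hh
    simpa [History.append] using ih hg

/-- The support of a round is a product over the parties. Alice's factor depends only on her input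
and her two links, so it can be borrowed from the run on `x'`, while the factors of Bob and Charlie
are kept. -/
theorem run_cut_alice {x x' : X} {y y' : Y} {t : ℕ} {h h' : History}
    (hh : h ∈ (N.run x y t).support) (hh' : h' ∈ (N.run x' y' t).support)
    (h12 : h.l12 = h'.l12) (h31 : h.l31 = h'.l31) : h ∈ (N.run x' y t).support := by
  induction t generalizing h h' with
  | zero => exact hh
  | succ t ih =>
    obtain ⟨g, hg, r, hr, rfl⟩ := N.mem_support_run_succ.1 hh
    obtain ⟨g', hg', r', hr', rfl⟩ := N.mem_support_run_succ.1 hh'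
    simp only [History.append, List.append_singleton_inj] at h12 h31
    refine N.mem_support_run_succ.2 ⟨g, ih hg hg' h12.1 h31.1, r, ?_, rfl⟩
    rw [mem_support_round] at hr hr' ⊢
    refine ⟨?_, hr.2⟩
    rw [h12.1, h12.2, h31.1, h31.2]
    exact hr'.1

theorem run_cut_bob {x x' : X} {y y' : Y} {t : ℕ} {h h' : History}
    (hh : h ∈ (N.run x y t).support) (hh' : h' ∈ (N.run x' y' t).support)
    (h12 : h.l12 = h'.l12) (h23 : h.l23 = h'.l23) : h ∈ (N.run x y' t).support := by
  induction t generalizing h h' with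
  | zero => exact hh
  | succ t ih =>
    obtain ⟨g, hg, r, hr, rfl⟩ := N.mem_support_run_succ.1 hh
    obtain ⟨g', hg', r', hr', rfl⟩ := N.mem_support_run_succ.1 hh'
    simp only [History.append, List.append_singleton_inj] at h12 h23
    refine N.mem_support_run_succ.2 ⟨g, ih hg hg' h12.1 h23.1, r, ?_, rfl⟩
    rw [mem_support_round] at hr hr' ⊢
    refine ⟨hr.1, ?_, hr.2.2⟩
    rw [h12.1, h12.2, h23.1, h23.2]
    exact hr'.2.1

theorem halted_iff {x : X} {y : Y} {h : History} :
    N.Halted x y h ↔ ∀ k, ∀ r ∈ (N.round x y (h.silence k)).support, r = silentRound :=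
  forall_congr' fun _ => PMF.eq_pure_iff

theorem halted_cut_alice {x x' : X} {y y' : Y} {h h' : History} (hh : N.Halted x y h)
    (hh' : N.Halted x' y' h') (h12 : h.l12 = h'.l12) (h31 : h.l31 = h'.l31) :
    N.Halted x' y h := by
  rw [halted_iff] at *
  intro k r hr
  rw [mem_support_round] at hr
  obtain ⟨a, ha⟩ := (N.alice x (h.silence k).l12 (h.silence k).l31).support_nonempty
  obtain ⟨b, hb⟩ := (N.bob y' (h'.silence k).l12 (h'.silence k).l23).support_nonempty
  obtain ⟨c, hc⟩ := (N.charlie (h'.silence k).l23 (h'.silence k).l31).support_nonempty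
  have e12 : (h.silence k).l12 = (h'.silence k).l12 := by simp [History.silence, h12]
  have e31 : (h.silence k).l31 = (h'.silence k).l31 := by simp [History.silence, h31]
  -- Completing the messages of Bob and Charlie by any possible message of Alice gives a round
  -- possible after `h`, which is silent; completing Alice's messages likewise gives one possible
  -- after `h'`. Together they silence every message of `r`.
  have h1 := hh k ⟨(a.1, r.l12.2), r.l23, (r.l31.1, a.2)⟩ (N.mem_support_round.2 ⟨ha, hr.2⟩)
  have h2 := hh' k ⟨(r.l12.1, b.1), (b.2, c.2), (c.1, r.l31.2)⟩
    (N.mem_support_round.2 ⟨by rw [← e12, ← e31]; exact hr.1, hb, hc⟩)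
  simp only [silentRound, Links.mk.injEq, Prod.mk.injEq] at h1 h2
  ext1
  · exact Prod.ext h2.1.1 h1.1.2
  · exact h1.2.1
  · exact Prod.ext h1.2.2.1 h2.2.2.2

theorem halted_cut_bob {x x' : X} {y y' : Y} {h h' : History} (hh : N.Halted x y h)
    (hh' : N.Halted x' y' h') (h12 : h.l12 = h'.l12) (h23 : h.l23 = h'.l23) :
    N.Halted x y' h := by
  rw [halted_iff] at *
  intro k r hr
  rw [mem_support_round] at hr
  obtain ⟨a, ha⟩ := (N.alice x' (h'.silence k).l12 (h'.silence k).l31).support_nonempty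
  obtain ⟨b, hb⟩ := (N.bob y (h.silence k).l12 (h.silence k).l23).support_nonempty
  obtain ⟨c, hc⟩ := (N.charlie (h'.silence k).l23 (h'.silence k).l31).support_nonempty
  have e12 : (h.silence k).l12 = (h'.silence k).l12 := by simp [History.silence, h12]
  have e23 : (h.silence k).l23 = (h'.silence k).l23 := by simp [History.silence, h23]
  have h1 := hh k ⟨(r.l12.1, b.1), (b.2, r.l23.2), r.l31⟩
    (N.mem_support_round.2 ⟨hr.1, hb, hr.2.2⟩)
  have h2 := hh' k ⟨(a.1, r.l12.2), (r.l23.1, c.2), (c.1, a.2)⟩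
    (N.mem_support_round.2 ⟨ha, by rw [← e12, ← e23]; exact hr.2.1, hc⟩)
  simp only [silentRound, Links.mk.injEq, Prod.mk.injEq] at h1 h2
  ext1
  · exact Prod.ext h1.1.1 h2.1.2
  · exact Prod.ext h2.2.1.1 h1.2.1.2
  · exact h1.2.2

end NextMessage

theorem History.silence_silence (h : History) (j k : ℕ) :
    (h.silence j).silence k = h.silence (j + k) := by
  simp [History.silence, List.replicate_append_replicate]

theorem History.append_silentRound (h : History) : h.append silentRound = h.silence 1 := rfl

theorem LinkHistory.concat_append (l l' : LinkHistory) :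
    LinkHistory.concat (l ++ l') = ((LinkHistory.concat l).1 ++ (LinkHistory.concat l').1,
      (LinkHistory.concat l).2 ++ (LinkHistory.concat l').2) := by
  simp [LinkHistory.concat]

theorem LinkHistory.concat_silence (l : LinkHistory) (k : ℕ) :
    LinkHistory.concat (l ++ List.replicate k ([], [])) = LinkHistory.concat l := by
  simp [LinkHistory.concat]

theorem History.transcript_silence (h : History) (k : ℕ) :
    (h.silence k).transcript = h.transcript := by
  simp [History.transcript, History.silence, LinkHistory.concat_silence]

namespace NextMessage

variable (N : NextMessage X Y Z)

theorem Halted.silence {N : NextMessage X Y Z} {x : X} {y : Y} {h : History}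
    (hh : N.Halted x y h) (k : ℕ) : N.Halted x y (h.silence k) := by
  intro j
  rw [History.silence_silence]
  exact hh _

theorem Halted.round_eq {N : NextMessage X Y Z} {x : X} {y : Y} {h : History}
    (hh : N.Halted x y h) : N.round x y h = PMF.pure silentRound := by
  have h0 : h.silence 0 = h := by simp [History.silence]
  have h1 := hh 0
  rwa [h0] at h1

theorem Halted.run_le {N : NextMessage X Y Z} {x : X} {y : Y} {h : History}
    (hh : N.Halted x y h) (t : ℕ) : N.run x y t h ≤ N.run x y (t + 1) (h.silence 1) := by
  rw [run, PMF.bind_apply]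
  refine le_trans ?_ (ENNReal.le_tsum h)
  rw [hh.round_eq, PMF.pure_map, History.append_silentRound, PMF.pure_apply_self, mul_one]

theorem Halted.silence_mem_support {N : NextMessage X Y Z} {x : X} {y : Y} {h : History}
    (hh : N.Halted x y h) {t : ℕ} (ht : h ∈ (N.run x y t).support) (k : ℕ) :
    h.silence k ∈ (N.run x y (t + k)).support := by
  induction k with
  | zero => simpa [History.silence] using ht
  | succ k ih =>
    rw [← History.silence_silence, ← add_assoc, PMF.mem_support_iff]
    intro h0
    have h1 := (hh.silence k).run_le (t + k)
    rw [h0] at h1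
    exact ih (le_antisymm h1 bot_le)

/-- Appending a silent round is injective and preserves both termination and the transcript. -/
theorem monotone_haltedProb (x : X) (y : Y) (m : Transcript) :
    Monotone fun t => (N.run x y t).toOuterMeasure {h | N.Halted x y h ∧ h.transcript = m} := by
  refine monotone_nat_of_le_succ fun t => ?_
  simp only [PMF.toOuterMeasure_apply]
  have hinj : Function.Injective fun h : History => h.silence 1 := by
    intro h h' he
    simp only [History.silence, Links.mk.injEq, List.append_cancel_right_eq] at he
    exact Links.ext he.1 he.2.1 he.2.2
  refine le_trans ?_ (ENNReal.tsum_comp_le_tsum_of_injective hinj _)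
  refine ENNReal.tsum_le_tsum fun h => ?_
  by_cases hh : N.Halted x y h ∧ h.transcript = m
  · rw [Set.indicator_of_mem (by exact hh), Set.indicator_of_mem]
    · exact hh.1.run_le t
    · exact ⟨hh.1.silence 1, by rw [History.transcript_silence, hh.2]⟩
  · rw [Set.indicator_of_notMem (by exact hh)]
    exact bot_le

theorem transcriptProb_ne_zero {x : X} {y : Y} {m : Transcript} :
    N.transcriptProb x y m ≠ 0 ↔
      ∃ t, ∃ h ∈ (N.run x y t).support, N.Halted x y h ∧ h.transcript = m := by
  rw [transcriptProb, ne_eq, ENNReal.iSup_eq_zero, not_forall]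
  refine exists_congr fun t => ?_
  rw [PMF.toOuterMeasure_apply_eq_zero_iff, Set.not_disjoint_iff]
  rfl

theorem run_map_take (x : X) (y : Y) {t T : ℕ} (h : t ≤ T) :
    (N.run x y T).map (History.take t) = N.run x y t := by
  induction T, h using Nat.le_induction with
  | base =>
    conv_rhs => rw [← PMF.map_id (N.run x y t)]
    refine PMF.ext fun g => ?_
    classical
    rw [PMF.map_apply, PMF.map_apply]
    refine tsum_congr fun h => ?_
    by_cases hh : h ∈ (N.run x y t).support
    · obtain ⟨h1, h2, h3⟩ := N.length_of_mem_support_run hh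
      have : History.take t h = h := by
        ext1 <;> simp [History.take, List.take_of_length_le, h1, h2, h3]
      rw [this, id]
    · rw [(PMF.apply_eq_zero_iff _ _).2 hh, ite_self, ite_self]
  | succ T hT ih =>
    rw [run, PMF.map_bind, ← ih]
    refine PMF.ext fun g => ?_
    classical
    rw [PMF.bind_apply, PMF.map_apply]
    refine tsum_congr fun h => ?_
    by_cases hh : h ∈ (N.run x y T).support
    · obtain ⟨h1, h2, h3⟩ := N.length_of_mem_support_run hh
      have : (History.take t ∘ h.append) = Function.const _ (History.take t h) := by
        funext r
        ext1 <;> simp [History.take, History.append, List.take_append_of_le_length, h1, h2, h3, hT]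
      rw [PMF.map_comp, this, PMF.map_const, PMF.pure_apply, mul_ite, mul_one, mul_zero]
    · rw [(PMF.apply_eq_zero_iff _ _).2 hh, ite_self, zero_mul]

end NextMessage

/-! ### Parsing transcripts -/

/-- Every exchange of `l` consists of codewords. -/
def LinkCode.Coded (C : LinkCode) (l : LinkHistory) : Prop :=
  ∀ i (hi : i < l.length), C.Allows (l.take i) l[i]

theorem LinkCode.Coded.append {C : LinkCode} {l : LinkHistory} (h : C.Coded l) {e : Exchange}
    (he : C.Allows l e) : C.Coded (l ++ [e]) := by
  intro i hi
  rcases Nat.lt_or_ge i l.length with h1 | h1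
  · rw [List.take_append_of_le_length h1.le, List.getElem_append_left h1]
    exact h i h1
  · have h2 : i = l.length := by
      simp at hi
      omega
    subst h2
    simpa using he

theorem IsPrefixFree.eq_of_append_eq {C : Set Word} (hC : IsPrefixFree C) {u v r s : Word}
    (hu : u ∈ C) (hv : v ∈ C) (h : u ++ r = v ++ s) : u = v := by
  rcases List.prefix_or_prefix_of_prefix (List.prefix_append u r)
    (h ▸ List.prefix_append v s) with h1 | h1
  · exact hC u hu v hv h1
  · exact (hC v hv u hu h1).symm

/-- Rounds are parsed one at a time: once the earlier rounds on the link agree, the codes of the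
next round agree, and a codeword is determined by any bit string that it begins. The length bounds
matter because the empty word may be a codeword, so the number of rounds cannot be read off the
bits. -/
theorem LinkCode.Coded.take_eq {C : LinkCode} {l l' : LinkHistory} (h : C.Coded l)
    (h' : C.Coded l') (he : LinkHistory.concat l = LinkHistory.concat l') {t : ℕ}
    (ht : t ≤ l.length) (ht' : t ≤ l'.length) : l.take t = l'.take t := by
  induction t with
  | zero => rfl
  | succ t ih =>
    have ih := ih (by omega) (by omega)
    have hl : l = l.take t ++ [l[t]] ++ l.drop (t + 1) := by simp
    have hl' : l' = l.take t ++ [l'[t]] ++ l'.drop (t + 1) := by rw [ih]; simp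
    have h1 := h t (by omega)
    have h1' := h' t (by omega)
    rw [← ih] at h1'
    rw [hl, hl'] at he
    simp only [LinkHistory.concat_append, List.append_assoc, Prod.mk.injEq,
      List.append_cancel_left_eq] at he
    have hfst : l[t].1 = l'[t].1 := (C.fwd_prefixFree _).eq_of_append_eq h1.1 h1'.1
      (by simpa [LinkHistory.concat] using he.1)
    have hsnd : l[t].2 = l'[t].2 := (C.bwd_prefixFree _).eq_of_append_eq h1.2 h1'.2
      (by simpa [LinkHistory.concat] using he.2)
    rw [List.take_succ_eq_append_getElem (by omega), List.take_succ_eq_append_getElem (by omega),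
      ih, Prod.ext hfst hsnd]

open Classical in
/-- The messages of the first `t` rounds, recovered from the concatenated bits on a link. -/
def LinkCode.decode (C : LinkCode) (t : ℕ) (e : Exchange) : LinkHistory :=
  if h : ∃ l, C.Coded l ∧ t ≤ l.length ∧ LinkHistory.concat l = e then h.choose.take t else []

theorem LinkCode.Coded.decode_concat {C : LinkCode} {l : LinkHistory} (h : C.Coded l) {t : ℕ}
    (ht : t ≤ l.length) : C.decode t (LinkHistory.concat l) = l.take t := by
  have hex : ∃ l', C.Coded l' ∧ t ≤ l'.length ∧ LinkHistory.concat l' = LinkHistory.concat l :=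
    ⟨l, h, ht, rfl⟩
  rw [LinkCode.decode, dif_pos hex]
  exact hex.choose_spec.1.take_eq h hex.choose_spec.2.2 hex.choose_spec.2.1 ht

namespace Protocol

variable (P : Protocol X Y Z)

/-- Prefix-free codes used by the protocol. -/
def code : Links LinkCode := P.prefixFree.choose

theorem coded_of_mem_support {x : X} {y : Y} {t : ℕ} {h : History}
    (hh : h ∈ (P.run x y t).support) :
    P.code.l12.Coded h.l12 ∧ P.code.l23.Coded h.l23 ∧ P.code.l31.Coded h.l31 := by
  induction t generalizing h with
  | zero =>
    have : h = ⟨[], [], []⟩ := by simpa [NextMessage.run] using hh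
    subst this
    refine ⟨?_, ?_, ?_⟩ <;> intro i hi <;> simp at hi
  | succ t ih =>
    obtain ⟨g, hg, r, hr, rfl⟩ := P.mem_support_run_succ.1 hh
    obtain ⟨h1, h2, h3⟩ := P.prefixFree.choose_spec x y t g hg r hr
    obtain ⟨i1, i2, i3⟩ := ih hg
    exact ⟨i1.append h1, i2.append h2, i3.append h3⟩

/-- The messages of the first `t` rounds, recovered from the transcript. -/
def decode (t : ℕ) (m : Transcript) : History :=
  ⟨P.code.l12.decode t m.l12, P.code.l23.decode t m.l23, P.code.l31.decode t m.l31⟩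

theorem decode_transcript {x : X} {y : Y} {t T : ℕ} {h : History}
    (hh : h ∈ (P.run x y T).support) (ht : t ≤ T) : P.decode t h.transcript = h.take t := by
  obtain ⟨h1, h2, h3⟩ := P.coded_of_mem_support hh
  obtain ⟨l1, l2, l3⟩ := P.length_of_mem_support_run hh
  rw [decode, History.take, Links.mk.injEq]
  exact ⟨h1.decode_concat (l1 ▸ ht), h2.decode_concat (l2 ▸ ht), h3.decode_concat (l3 ▸ ht)⟩

theorem mem_support_transcriptLaw {x : X} {y : Y} {m : Transcript} :
    m ∈ (P.transcriptLaw x y).support ↔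
      ∃ t, ∃ h ∈ (P.run x y t).support, P.Halted x y h ∧ h.transcript = m :=
  P.transcriptProb_ne_zero

/-- The law of the first `t` rounds, as recovered from the final transcript. -/
theorem transcriptLaw_map_decode (x : X) (y : Y) (t : ℕ) :
    (P.transcriptLaw x y).map (P.decode t) = P.run x y t := by
  classical
  -- Both sides are probability laws, so one inequality suffices, and only executions that have
  -- already halted need be counted.
  refine PMF.eq_of_le fun g => ?_
  have hmono : ∀ m, Monotone fun T => if g = P.decode t m then
      (P.run x y T).toOuterMeasure {h | P.Halted x y h ∧ h.transcript = m} else 0 := by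
    intro m T T' hT
    dsimp only
    split_ifs
    · exact P.monotone_haltedProb x y m hT
    · exact le_rfl
  have hle : ∀ T, t ≤ T → ∑' m, (if g = P.decode t m then
      (P.run x y T).toOuterMeasure {h | P.Halted x y h ∧ h.transcript = m} else 0) ≤
        P.run x y t g := by
    intro T hT
    rw [← P.run_map_take x y hT, PMF.map_apply]
    have : ∀ m, (if g = P.decode t m then
        (P.run x y T).toOuterMeasure {h | P.Halted x y h ∧ h.transcript = m} else 0) =
        ∑' h, if g = P.decode t m ∧ P.Halted x y h ∧ h.transcript = m
          then P.run x y T h else 0 := by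
      intro m
      split_ifs with hm
      · rw [PMF.toOuterMeasure_apply]
        refine tsum_congr fun h => ?_
        simp [Set.indicator_apply, hm]
      · simp [hm]
    simp only [this]
    rw [ENNReal.tsum_comm]
    refine ENNReal.tsum_le_tsum fun h => ?_
    by_cases hh : h ∈ (P.run x y T).support
    · rw [tsum_eq_single h.transcript]
      · rw [P.decode_transcript hh hT]
        split_ifs with h1 h2
        · exact le_rfl
        · exact absurd h1.1 h2
        · exact bot_le
        · exact le_rfl
      · intro m hm
        rw [if_neg]
        exact fun h' => hm h'.2.2.symm
    · rw [(PMF.apply_eq_zero_iff _ _).2 hh]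
      simp
  rw [PMF.map_apply, ENNReal.tsum_eq_iSup_sum]
  refine iSup_le fun s => ?_
  have hiSup : ∀ m, (if g = P.decode t m then P.transcriptLaw x y m else 0) = ⨆ T,
      if g = P.decode t m then
        (P.run x y T).toOuterMeasure {h | P.Halted x y h ∧ h.transcript = m} else 0 := by
    intro m
    split_ifs
    · rfl
    · simp
  simp only [hiSup]
  -- Monotonicity in the number of rounds lets the supremum pass through the finite sum; it is then
  -- enough to bound a single T, which may be taken at least t.
  rw [ENNReal.finsetSum_iSup_of_monotone hmono]
  refine iSup_le fun T => ?_
  refine le_trans (Finset.sum_le_sum fun m _ => hmono m (le_max_left T t)) ?_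
  exact (ENNReal.sum_le_tsum s).trans (hle _ (le_max_right T t))

theorem eventually_transcript_decode {x : X} {y : Y} {m : Transcript}
    (hm : m ∈ (P.transcriptLaw x y).support) :
    ∀ᶠ t in Filter.atTop, (P.decode t m).transcript = m := by
  obtain ⟨T, h, hh, hhalt, rfl⟩ := P.mem_support_transcriptLaw.1 hm
  filter_upwards [Filter.eventually_ge_atTop T] with t ht
  obtain ⟨k, rfl⟩ := Nat.exists_eq_add_of_le ht
  have h1 := hhalt.silence_mem_support hh k
  obtain ⟨l1, l2, l3⟩ := P.length_of_mem_support_run h1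
  have h2 : History.take (T + k) (h.silence k) = h.silence k := by
    ext1 <;> simp only [History.take, List.take_of_length_le, l1, l2, l3, le_refl]
  rw [← h.transcript_silence k, P.decode_transcript h1 le_rfl, h2]

/-- Two executions that halt can be cut down to the same number of rounds. -/
theorem exists_common_length {x x' : X} {y y' : Y} {m m' : Transcript}
    (hm : m ∈ (P.transcriptLaw x y).support) (hm' : m' ∈ (P.transcriptLaw x' y').support) :
    ∃ t, ∃ h ∈ (P.run x y t).support, ∃ h' ∈ (P.run x' y' t).support,
      P.Halted x y h ∧ P.Halted x' y' h' ∧ h.transcript = m ∧ h'.transcript = m' := by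
  obtain ⟨t, h, hh, hhalt, rfl⟩ := P.mem_support_transcriptLaw.1 hm
  obtain ⟨t', h', hh', hhalt', rfl⟩ := P.mem_support_transcriptLaw.1 hm'
  refine ⟨t + t', h.silence t', hhalt.silence_mem_support hh t', h'.silence t, ?_,
    hhalt.silence t', hhalt'.silence t, h.transcript_silence _, h'.transcript_silence _⟩
  rw [add_comm]
  exact hhalt'.silence_mem_support hh' t

theorem _root_.LinkCode.Coded.eq_of_concat_eq {C : LinkCode} {l l' : LinkHistory} (h : C.Coded l)
    (h' : C.Coded l') (he : LinkHistory.concat l = LinkHistory.concat l')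
    (hl : l.length = l'.length) : l = l' := by
  have h1 := h.take_eq h' he le_rfl hl.le
  rwa [List.take_length, List.take_of_length_le hl.ge] at h1

/-- The cut-and-paste property for Alice's links. -/
theorem transcript_cut_alice {x x' : X} {y y' : Y} {m m' : Transcript}
    (hm : m ∈ (P.transcriptLaw x y).support) (hm' : m' ∈ (P.transcriptLaw x' y').support)
    (h12 : m.l12 = m'.l12) (h31 : m.l31 = m'.l31) : m ∈ (P.transcriptLaw x' y).support := by
  obtain ⟨t, h, hh, h', hh', hhalt, hhalt', rfl, rfl⟩ := P.exists_common_length hm hm'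
  obtain ⟨c1, -, c3⟩ := P.coded_of_mem_support hh
  obtain ⟨c1', -, c3'⟩ := P.coded_of_mem_support hh'
  obtain ⟨l1, -, l3⟩ := P.length_of_mem_support_run hh
  obtain ⟨l1', -, l3'⟩ := P.length_of_mem_support_run hh'
  have e12 := c1.eq_of_concat_eq c1' h12 (l1.trans l1'.symm)
  have e31 := c3.eq_of_concat_eq c3' h31 (l3.trans l3'.symm)
  exact P.mem_support_transcriptLaw.2 ⟨t, h, P.run_cut_alice hh hh' e12 e31,
    P.halted_cut_alice hhalt hhalt' e12 e31, rfl⟩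

/-- The cut-and-paste property for Bob's links. -/
theorem transcript_cut_bob {x x' : X} {y y' : Y} {m m' : Transcript}
    (hm : m ∈ (P.transcriptLaw x y).support) (hm' : m' ∈ (P.transcriptLaw x' y').support)
    (h12 : m.l12 = m'.l12) (h23 : m.l23 = m'.l23) : m ∈ (P.transcriptLaw x y').support := by
  obtain ⟨t, h, hh, h', hh', hhalt, hhalt', rfl, rfl⟩ := P.exists_common_length hm hm'
  obtain ⟨c1, c2, -⟩ := P.coded_of_mem_support hh
  obtain ⟨c1', c2', -⟩ := P.coded_of_mem_support hh'
  obtain ⟨l1, l2, -⟩ := P.length_of_mem_support_run hh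
  obtain ⟨l1', l2', -⟩ := P.length_of_mem_support_run hh'
  have e12 := c1.eq_of_concat_eq c1' h12 (l1.trans l1'.symm)
  have e23 := c2.eq_of_concat_eq c2' h23 (l2.trans l2'.symm)
  exact P.mem_support_transcriptLaw.2 ⟨t, h, P.run_cut_bob hh hh' e12 e23,
    P.halted_cut_bob hhalt hhalt' e12 e23, rfl⟩

end Protocol

end Executions

/-! ### Consequences of security -/

section Security

theorem markovChain_map {Ω Ω' α β γ : Type} {μ : PMF Ω} {f : Ω → Ω'} {T : Ω' → α} {U : Ω' → β}
    {V : Ω' → γ} : MarkovChain (μ.map f) T U V ↔ MarkovChain μ (T ∘ f) (U ∘ f) (V ∘ f) := by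
  simp only [MarkovChain, PMF.map_comp]
  rfl

/-- If `F - U - V` is a Markov chain and `(U, V)` determines the law of `F`, then so does `U`. -/
theorem map_eq_of_markovChain {S Ω' α β γ : Type} {μ : PMF S} {κ : S → PMF Ω'} {F : Ω' → α}
    {U : S → β} {V : S → γ} (hinj : ∀ s s', U s = U s' → V s = V s' → s = s')
    (h : MarkovChain (extend μ κ) (fun p => F p.2) (fun p => U p.1) (fun p => V p.1))
    {s s' : S} (hs : μ s ≠ 0) (hs' : μ s' ≠ 0) (hU : U s = U s') :
    (κ s).map F = (κ s').map F := by
  classical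
  have hmap : ∀ {τ : Type} (T : S → τ), (extend μ κ).map (fun p => T p.1) = μ.map T := by
    intro τ T
    conv_rhs => rw [← extend_map_fst μ κ, PMF.map_comp]
    rfl
  -- As (U, V) identifies `r`, the event (U, V) = (U r, V r) has probability `μ r`, and the Markov
  -- identity can be divided by it.
  have key : ∀ r, μ r ≠ 0 → ∀ t, (κ r).map F t * μ.map U (U r) =
      (extend μ κ).map (fun p => (F p.2, U p.1)) (t, U r) := by
    intro r hr t
    have h1 : (extend μ κ).map (fun p => (F p.2, U p.1, V p.1)) (t, U r, V r) =
        μ r * (κ r).map F t := by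
      rw [PMF.map_apply, ENNReal.tsum_prod', tsum_eq_single r]
      · rw [PMF.map_apply, ← ENNReal.tsum_mul_left]
        refine tsum_congr fun a => ?_
        simp [extend_apply]
      · intro r' hr'
        refine ENNReal.tsum_eq_zero.2 fun a => if_neg ?_
        intro he
        simp only [Prod.mk.injEq] at he
        exact hr' (hinj _ _ he.2.1 he.2.2).symm
    have h2 : (extend μ κ).map (fun p => (U p.1, V p.1)) (U r, V r) = μ r := by
      rw [hmap fun r => (U r, V r), PMF.map_apply, tsum_eq_single r]
      · simp
      · intro r' hr'
        refine if_neg ?_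
        intro he
        simp only [Prod.mk.injEq] at he
        exact hr' (hinj _ _ he.1 he.2).symm
    have h3 := h t (U r) (V r)
    rw [h1, h2, hmap U, mul_assoc, mul_comm _ (μ r)] at h3
    exact (ENNReal.mul_right_inj hr (μ.apply_ne_top r)).1 h3
  refine PMF.ext fun t => ?_
  have hne : μ.map U (U s) ≠ 0 := fiberProb_ne_zero U hs
  rw [← ENNReal.mul_left_inj hne ((μ.map U).apply_ne_top _), key s hs t, hU, key s' hs' t]

/-- The bitwise AND. -/
abbrev bitAnd {n : ℕ} (x y : Fin n → Bool) : Fin n → Bool := fun i => x i && y i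

theorem bitAnd_true {n : ℕ} (x : Fin n → Bool) : (bitAnd x fun _ => true) = x := by
  funext i
  simp

theorem true_bitAnd {n : ℕ} (x : Fin n → Bool) : (bitAnd (fun _ => true) x) = x := by
  funext i
  simp

/-- The properties of the transcripts of a secure protocol for the bitwise AND: the view of each
party determines the input or output of that party, and its law depends on nothing else. -/
structure PrivateAnd {n : ℕ} (K : (Fin n → Bool) → (Fin n → Bool) → PMF Transcript) : Prop where
  alice_law : ∀ x y y', (K x y).map (fun m => (m.l12, m.l31)) =
    (K x y').map (fun m => (m.l12, m.l31))
  bob_law : ∀ x x' y, (K x y).map (fun m => (m.l12, m.l23)) =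
    (K x' y).map (fun m => (m.l12, m.l23))
  charlie_law : ∀ x y x' y', bitAnd x y = bitAnd x' y' →
    (K x y).map (fun m => (m.l23, m.l31)) = (K x' y').map (fun m => (m.l23, m.l31))
  alice_det : ∃ ξ : Exchange → Exchange → Fin n → Bool,
    ∀ x y, ∀ m ∈ (K x y).support, ξ m.l12 m.l31 = x
  bob_det : ∃ ξ : Exchange → Exchange → Fin n → Bool,
    ∀ x y, ∀ m ∈ (K x y).support, ξ m.l12 m.l23 = y
  charlie_det : ∃ ξ : Exchange → Exchange → Fin n → Bool,
    ∀ x y, ∀ m ∈ (K x y).support, ξ m.l23 m.l31 = bitAnd x y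

theorem exists_determining {S τ E : Type} [Nonempty τ] (K : S → PMF Transcript) (F : S → τ)
    (a b : Transcript → E)
    (h : ∀ s s' m m', m ∈ (K s).support → m' ∈ (K s').support → a m = a m' → b m = b m' →
      F s = F s') : ∃ ξ : E → E → τ, ∀ s, ∀ m ∈ (K s).support, ξ (a m) (b m) = F s := by
  classical
  refine ⟨fun u v => if hex : ∃ s, ∃ m ∈ (K s).support, a m = u ∧ b m = v then F hex.choose
    else Classical.arbitrary τ, fun s m hm => ?_⟩
  have hex : ∃ s', ∃ m' ∈ (K s').support, a m' = a m ∧ b m' = b m := ⟨s, m, hm, rfl, rfl⟩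
  dsimp only
  rw [dif_pos hex]
  obtain ⟨m', hm', h1, h2⟩ := hex.choose_spec
  exact h _ _ m' m hm' hm h1 h2

variable {n : ℕ} {P : Protocol (Fin n → Bool) (Fin n → Bool) (Fin n → Bool)}
  {pXY : PMF ((Fin n → Bool) × (Fin n → Bool))}

theorem Protocol.Secure.output_eq (hP : P.Secure pXY (andFn n)) (hfull : ∀ xy, pXY xy ≠ 0)
    {x y : Fin n → Bool} {m : Transcript} (hm : m ∈ (P.transcriptLaw x y).support) :
    P.output m.l23 m.l31 = PMF.pure (bitAnd x y) := by
  have h := hP.correct x y (hfull _)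
  rw [andFn, PMF.eq_pure_iff] at h
  rw [PMF.eq_pure_iff]
  intro z hz
  exact h z ((PMF.mem_support_bind_iff _ _ _).2 ⟨m, hm, hz⟩)

theorem Protocol.Secure.law_eq (hP : P.Secure pXY (andFn n)) (hfull : ∀ xy, pXY xy ≠ 0) :
    P.law pXY = (extend pXY fun s => P.transcriptLaw s.1 s.2).map
      fun p => ⟨p.1.1, p.1.2, bitAnd p.1.1 p.1.2, p.2⟩ := by
  rw [Protocol.law, extend, PMF.map_bind]
  congr 1
  funext s
  rw [PMF.map_comp, ← PMF.bind_pure_comp]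
  refine PMF.ext fun ω => ?_
  rw [PMF.bind_apply, PMF.bind_apply]
  refine tsum_congr fun m => ?_
  by_cases hm : m ∈ (P.transcriptLaw s.1 s.2).support
  · rw [hP.output_eq hfull hm, PMF.pure_map]
    rfl
  · rw [(PMF.apply_eq_zero_iff _ _).2 hm, zero_mul, zero_mul]

theorem map_eq_of_markovChain_inputs {K : (Fin n → Bool) → (Fin n → Bool) → PMF Transcript}
    {α β γ : Type} (hfull : ∀ xy, pXY xy ≠ 0) (F : Transcript → α)
    {U : (Fin n → Bool) × (Fin n → Bool) → β} {V : (Fin n → Bool) × (Fin n → Bool) → γ}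
    (h : MarkovChain (extend pXY fun s => K s.1 s.2) (fun p => F p.2) (fun p => U p.1)
      (fun p => V p.1))
    (hinj : ∀ s s', U s = U s' → V s = V s' → s = s') {x y x' y' : Fin n → Bool}
    (hU : U (x, y) = U (x', y')) : (K x y).map F = (K x' y').map F :=
  map_eq_of_markovChain (κ := fun s => K s.1 s.2) hinj h (hfull (x, y)) (hfull (x', y')) hU

theorem Protocol.Secure.alice_law (hP : P.Secure pXY (andFn n)) (hfull : ∀ xy, pXY xy ≠ 0)
    (x y y' : Fin n → Bool) : (P.transcriptLaw x y).map (fun m => (m.l12, m.l31)) =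
      (P.transcriptLaw x y').map (fun m => (m.l12, m.l31)) := by
  have h := hP.private_alice
  rw [hP.law_eq hfull, markovChain_map] at h
  have h' : MarkovChain (extend pXY fun s => P.transcriptLaw s.1 s.2)
    (fun p => (p.2.l12, p.2.l31)) (fun p => p.1.1) (fun p => (p.1.2, bitAnd p.1.1 p.1.2)) := h
  refine map_eq_of_markovChain_inputs (K := P.transcriptLaw) hfull (fun m => (m.l12, m.l31))
    (U := fun s => s.1) (V := fun s => (s.2, bitAnd s.1 s.2)) h' ?_ rfl
  exact fun s s' h1 h2 => Prod.ext h1 (Prod.mk.inj h2).1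

theorem Protocol.Secure.bob_law (hP : P.Secure pXY (andFn n)) (hfull : ∀ xy, pXY xy ≠ 0)
    (x x' y : Fin n → Bool) : (P.transcriptLaw x y).map (fun m => (m.l12, m.l23)) =
      (P.transcriptLaw x' y).map (fun m => (m.l12, m.l23)) := by
  have h := hP.private_bob
  rw [hP.law_eq hfull, markovChain_map] at h
  have h' : MarkovChain (extend pXY fun s => P.transcriptLaw s.1 s.2)
    (fun p => (p.2.l12, p.2.l23)) (fun p => p.1.2) (fun p => (p.1.1, bitAnd p.1.1 p.1.2)) := h
  refine map_eq_of_markovChain_inputs (K := P.transcriptLaw) hfull (fun m => (m.l12, m.l23))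
    (U := fun s => s.2) (V := fun s => (s.1, bitAnd s.1 s.2)) h' ?_ rfl
  exact fun s s' h1 h2 => Prod.ext (Prod.mk.inj h2).1 h1

theorem Protocol.Secure.charlie_law (hP : P.Secure pXY (andFn n)) (hfull : ∀ xy, pXY xy ≠ 0)
    {x y x' y' : Fin n → Bool} (he : bitAnd x y = bitAnd x' y') :
    (P.transcriptLaw x y).map (fun m => (m.l23, m.l31)) =
      (P.transcriptLaw x' y').map (fun m => (m.l23, m.l31)) := by
  have h := hP.private_charlie
  rw [hP.law_eq hfull, markovChain_map] at h
  have h' : MarkovChain (extend pXY fun s => P.transcriptLaw s.1 s.2)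
    (fun p => (p.2.l23, p.2.l31)) (fun p => bitAnd p.1.1 p.1.2) (fun p => (p.1.1, p.1.2)) := h
  refine map_eq_of_markovChain_inputs (K := P.transcriptLaw) hfull (fun m => (m.l23, m.l31))
    (U := fun s => bitAnd s.1 s.2) (V := fun s => (s.1, s.2)) h' ?_ he
  exact fun s s' _ h2 => h2

theorem Protocol.Secure.charlie_det (hP : P.Secure pXY (andFn n)) (hfull : ∀ xy, pXY xy ≠ 0)
    {x y x' y' : Fin n → Bool} {m m' : Transcript} (hm : m ∈ (P.transcriptLaw x y).support)
    (hm' : m' ∈ (P.transcriptLaw x' y').support) (h23 : m.l23 = m'.l23) (h31 : m.l31 = m'.l31) :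
    bitAnd x y = bitAnd x' y' := by
  have h1 := hP.output_eq hfull hm
  rw [h23, h31, hP.output_eq hfull hm', PMF.eq_pure_iff] at h1
  exact (h1 (bitAnd x' y') (by simp)).symm

theorem PMF.exists_mem_support_of_map_eq {Ω α : Type} {p p' : PMF Ω} {F : Ω → α}
    (h : p.map F = p'.map F) {m : Ω} (hm : m ∈ p.support) : ∃ m' ∈ p'.support, F m' = F m := by
  have h1 : F m ∈ (p.map F).support := (PMF.mem_support_map_iff _ _ _).2 ⟨m, hm, rfl⟩
  rw [h, PMF.mem_support_map_iff] at h1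
  exact h1

/-- By privacy against Bob's input, Alice's transcripts also occur when Bob holds the all-ones
vector, in some transcript m₁ on input x. Cut and paste makes m₁ possible on x' too. Charlie must
then output both x and x' from the same transcript. -/
theorem Protocol.Secure.alice_det (hP : P.Secure pXY (andFn n)) (hfull : ∀ xy, pXY xy ≠ 0)
    {x y x' y' : Fin n → Bool} {m m' : Transcript} (hm : m ∈ (P.transcriptLaw x y).support)
    (hm' : m' ∈ (P.transcriptLaw x' y').support) (h12 : m.l12 = m'.l12) (h31 : m.l31 = m'.l31) :
    x = x' := by
  obtain ⟨m₁, hm₁, he⟩ :=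
    PMF.exists_mem_support_of_map_eq (hP.alice_law hfull x y fun _ => true) hm
  simp only [Prod.mk.injEq] at he
  have hm₂ := P.transcript_cut_alice hm₁ hm' (he.1.trans h12) (he.2.trans h31)
  have h := hP.charlie_det hfull hm₁ hm₂ rfl rfl
  rwa [bitAnd_true, bitAnd_true] at h

theorem Protocol.Secure.bob_det (hP : P.Secure pXY (andFn n)) (hfull : ∀ xy, pXY xy ≠ 0)
    {x y x' y' : Fin n → Bool} {m m' : Transcript} (hm : m ∈ (P.transcriptLaw x y).support)
    (hm' : m' ∈ (P.transcriptLaw x' y').support) (h12 : m.l12 = m'.l12) (h23 : m.l23 = m'.l23) :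
    y = y' := by
  obtain ⟨m₁, hm₁, he⟩ :=
    PMF.exists_mem_support_of_map_eq (hP.bob_law hfull x (fun _ => true) y) hm
  simp only [Prod.mk.injEq] at he
  have hm₂ := P.transcript_cut_bob hm₁ hm' (he.1.trans h12) (he.2.trans h23)
  have h := hP.charlie_det hfull hm₁ hm₂ rfl rfl
  rwa [true_bitAnd, true_bitAnd] at h

theorem Protocol.Secure.privateAnd (hP : P.Secure pXY (andFn n)) (hfull : ∀ xy, pXY xy ≠ 0) :
    PrivateAnd P.transcriptLaw := by
  refine ⟨hP.alice_law hfull, hP.bob_law hfull, fun x y x' y' => hP.charlie_law hfull, ?_, ?_, ?_⟩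
  · obtain ⟨ξ, hξ⟩ := exists_determining (fun s : (Fin n → Bool) × (Fin n → Bool) =>
      P.transcriptLaw s.1 s.2) Prod.fst Links.l12 Links.l31
      fun s s' m m' => hP.alice_det hfull
    exact ⟨ξ, fun x y => hξ (x, y)⟩
  · obtain ⟨ξ, hξ⟩ := exists_determining (fun s : (Fin n → Bool) × (Fin n → Bool) =>
      P.transcriptLaw s.1 s.2) Prod.snd Links.l12 Links.l23
      fun s s' m m' => hP.bob_det hfull
    exact ⟨ξ, fun x y => hξ (x, y)⟩
  · obtain ⟨ξ, hξ⟩ := exists_determining (fun s : (Fin n → Bool) × (Fin n → Bool) =>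
      P.transcriptLaw s.1 s.2) (fun s => bitAnd s.1 s.2) Links.l23 Links.l31
      fun s s' m m' => hP.charlie_det hfull
    exact ⟨ξ, fun x y => hξ (x, y)⟩

namespace PrivateAnd

variable {K : (Fin n → Bool) → (Fin n → Bool) → PMF Transcript}

theorem map_comp_eq {Ω α β : Type} {p p' : PMF Ω} {F : Ω → α} (h : p.map F = p'.map F)
    (g : α → β) : p.map (g ∘ F) = p'.map (g ∘ F) := by
  rw [← PMF.map_comp, ← PMF.map_comp, h]

/-- Alice's privacy allows Bob's input to be replaced by 0; then the output is 0 whatever Alice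
holds, and Charlie's privacy removes the dependence on her input. -/
theorem law31_eq (hK : PrivateAnd K) (x y x' y' : Fin n → Bool) :
    (K x y).map Links.l31 = (K x' y').map Links.l31 := by
  have h1 : ∀ x y y', (K x y).map Links.l31 = (K x y').map Links.l31 := fun x y y' =>
    map_comp_eq (hK.alice_law x y y') Prod.snd
  have h2 : (K x fun _ => false).map Links.l31 = (K x' fun _ => false).map Links.l31 :=
    map_comp_eq (hK.charlie_law x (fun _ => false) x' (fun _ => false) (by funext i; simp)) Prod.snd
  rw [h1 x y fun _ => false, h2, h1]

theorem law23_eq (hK : PrivateAnd K) (x y x' y' : Fin n → Bool) :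
    (K x y).map Links.l23 = (K x' y').map Links.l23 := by
  have h1 : ∀ x x' y, (K x y).map Links.l23 = (K x' y).map Links.l23 := fun x x' y =>
    map_comp_eq (hK.bob_law x x' y) Prod.snd
  have h2 : (K (fun _ => false) y).map Links.l23 = (K (fun _ => false) y').map Links.l23 :=
    map_comp_eq (hK.charlie_law (fun _ => false) y (fun _ => false) y' (by funext i; simp)) Prod.fst
  rw [h1 x (fun _ => false) y, h2, h1]

theorem law12_eq (hK : PrivateAnd K) (x y x' y' : Fin n → Bool) :
    (K x y).map Links.l12 = (K x' y').map Links.l12 :=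
  (map_comp_eq (hK.alice_law x y y') Prod.fst : _).trans
    (map_comp_eq (hK.bob_law x x' y') Prod.fst)

/-- Exchanging the roles of Alice and Bob. -/
theorem swap (hK : PrivateAnd K) :
    PrivateAnd fun x y => (K y x).map fun m => ⟨m.l12, m.l31, m.l23⟩ := by
  have hcomm : ∀ x y : Fin n → Bool, bitAnd x y = bitAnd y x := fun x y => by
    funext i
    exact Bool.and_comm _ _
  refine ⟨?_, ?_, ?_, ?_, ?_, ?_⟩
  · intro x y y'
    rw [PMF.map_comp, PMF.map_comp]
    exact hK.bob_law y y' x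
  · intro x x' y
    rw [PMF.map_comp, PMF.map_comp]
    exact hK.alice_law y x x'
  · intro x y x' y' h
    rw [PMF.map_comp, PMF.map_comp]
    refine map_comp_eq (hK.charlie_law y x y' x' ?_) Prod.swap
    rw [hcomm, h, hcomm]
  · obtain ⟨ξ, hξ⟩ := hK.bob_det
    refine ⟨ξ, fun x y m hm => ?_⟩
    obtain ⟨m', hm', rfl⟩ := (PMF.mem_support_map_iff _ _ _).1 hm
    exact hξ y x m' hm'
  · obtain ⟨ξ, hξ⟩ := hK.alice_det
    refine ⟨ξ, fun x y m hm => ?_⟩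
    obtain ⟨m', hm', rfl⟩ := (PMF.mem_support_map_iff _ _ _).1 hm
    exact hξ y x m' hm'
  · obtain ⟨ξ, hξ⟩ := hK.charlie_det
    refine ⟨fun a b => ξ b a, fun x y m hm => ?_⟩
    obtain ⟨m', hm', rfl⟩ := (PMF.mem_support_map_iff _ _ _).1 hm
    rw [hcomm]
    exact hξ y x m' hm'

end PrivateAnd

end Security

/-! ### Entropies of product distributions -/

section ProductLaws

variable {Ω Ω' α β γ : Type}

theorem cEnt_eq_of_map_eq {μ : PMF Ω} {μ' : PMF Ω'} {T : Ω → α} {C : Ω → β} {T' : Ω' → α}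
    {C' : Ω' → β} (h : μ.map (pair T C) = μ'.map (pair T' C')) : cEnt μ T C = cEnt μ' T' C' := by
  have h1 := cEnt_map μ (pair T C) Prod.fst Prod.snd
  have h2 := cEnt_map μ' (pair T' C') Prod.fst Prod.snd
  rw [h] at h1
  exact h1.symm.trans h2

theorem ent_eq_of_map_eq {μ : PMF Ω} {μ' : PMF Ω'} {T : Ω → α} {T' : Ω' → α}
    (h : μ.map T = μ'.map T') : ent μ T = ent μ' T' := by
  have h1 := ent_map μ T id
  have h2 := ent_map μ' T' id
  rw [h] at h1
  exact h1.symm.trans h2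

/-- If the law of `F` is a function of `G`, then the joint law of `F` and `G` is determined by that
function and the law of `G`. -/
theorem map_extend_eq {μ : PMF Ω} {κ : Ω → PMF Ω'} {F : Ω' → α} {G : Ω → β} {l : β → PMF α}
    (h : ∀ ω, μ ω ≠ 0 → (κ ω).map F = l (G ω)) :
    (extend μ κ).map (fun p => (F p.2, G p.1)) = (extend (μ.map G) l).map Prod.swap := by
  rw [extend, extend, PMF.map_bind, PMF.map_bind, PMF.bind_map]
  refine PMF.ext fun c => ?_
  rw [PMF.bind_apply, PMF.bind_apply]
  refine tsum_congr fun ω => ?_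
  by_cases h0 : μ ω = 0
  · rw [h0, zero_mul, zero_mul]
  · rw [Function.comp_apply, ← h ω h0, PMF.map_comp, PMF.map_comp, PMF.map_comp]
    rfl

theorem map_extend_snd {μ : PMF Ω} {κ : Ω → PMF Ω'} {F : Ω' → α} {l : PMF α}
    (h : ∀ ω, μ ω ≠ 0 → (κ ω).map F = l) : (extend μ κ).map (fun p => F p.2) = l := by
  rw [extend, PMF.map_bind]
  conv_rhs => rw [← PMF.bind_const μ l]
  refine PMF.ext fun c => ?_
  rw [PMF.bind_apply, PMF.bind_apply]
  refine tsum_congr fun ω => ?_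
  by_cases h0 : μ ω = 0
  · rw [h0, zero_mul, zero_mul]
  · rw [← h ω h0, PMF.map_comp]
    rfl

theorem ent_id (μ : PMF Ω) : ent μ id = ∑' ω, μ ω * ENNReal.ofReal (-Real.log (μ ω).toReal) := by
  refine expect_congr fun ω h0 => ?_
  have h1 : fiberProb μ (pair id fun _ => ()) ω = μ ω := by
    rw [fiberProb_congr (T' := id) (by simp), fiberProb, PMF.map_id, id]
  rw [logProb_const, logProb, h1, zero_sub]

theorem cEnt_extend_snd (μ : PMF Ω) (κ : Ω → PMF Ω') : cEnt (extend μ κ) Prod.snd Prod.fst =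
    ∑' p, extend μ κ p * ENNReal.ofReal (-Real.log (κ p.1 p.2).toReal) := by
  refine expect_congr fun p hp => ?_
  obtain ⟨h1, h2⟩ := extend_ne_zero.1 hp
  have e1 : fiberProb (extend μ κ) (pair Prod.snd Prod.fst) p = μ p.1 * κ p.1 p.2 := by
    rw [fiberProb_congr (T' := id) (by simp [Prod.ext_iff, and_comm]), fiberProb, PMF.map_id, id,
      extend_apply]
  have e2 : fiberProb (extend μ κ) Prod.fst p = μ p.1 := by
    rw [fiberProb, extend_map_fst]
  rw [logProb, logProb, e1, e2, ENNReal.toReal_mul, Real.log_mul]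
  · congr 1
    ring
  · exact (ENNReal.toReal_pos h1 (μ.apply_ne_top _)).ne'
  · exact (ENNReal.toReal_pos h2 ((κ p.1).apply_ne_top _)).ne'

variable {n : ℕ}

/-- A vector of independent bits, the law of the bit with index `i` being `w (x i)`. -/
def coordLaw (w : Bool → Bool → ℝ≥0∞) (hw : ∀ a, w a true + w a false = 1) (x : Fin n → Bool) :
    PMF (Fin n → Bool) :=
  PMF.ofFintype (fun y => ∏ i, w (x i) (y i)) (by
    rw [← Fintype.piFinset_univ, ← Finset.prod_univ_sum]
    simp [hw])

theorem coordLaw_apply (w : Bool → Bool → ℝ≥0∞) (hw : ∀ a, w a true + w a false = 1)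
    (x y : Fin n → Bool) : coordLaw w hw x y = ∏ i, w (x i) (y i) := rfl

theorem coordLaw_ne_zero {w : Bool → Bool → ℝ≥0∞} {hw : ∀ a, w a true + w a false = 1}
    {x y : Fin n → Bool} : coordLaw w hw x y ≠ 0 ↔ ∀ i, w (x i) (y i) ≠ 0 := by
  simp [coordLaw_apply, Finset.prod_ne_zero_iff]

theorem neg_log_coordLaw {w : Bool → Bool → ℝ≥0∞} {hw : ∀ a, w a true + w a false = 1}
    {x y : Fin n → Bool} (h : coordLaw w hw x y ≠ 0) :
    -Real.log (coordLaw w hw x y).toReal = ∑ i, -Real.log (w (x i) (y i)).toReal := by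
  have hne : ∀ i, (w (x i) (y i)).toReal ≠ 0 := by
    intro i
    have hle : w (x i) (y i) ≤ 1 := by
      rw [← hw (x i)]
      cases y i
      · exact le_add_self
      · exact le_self_add
    exact (ENNReal.toReal_pos (coordLaw_ne_zero.1 h i)
      (ne_top_of_le_ne_top ENNReal.one_ne_top hle)).ne'
  rw [coordLaw_apply, ENNReal.toReal_prod, Real.log_prod fun i _ => hne i, Finset.sum_neg_distrib]

theorem ent_coordLaw {w : Bool → Bool → ℝ≥0∞} {hw : ∀ a, w a true + w a false = 1}
    (c : Fin n → Bool) {g : Bool → ℝ} (hg : ∀ a b, w a b ≠ 0 → -Real.log (w a b).toReal = g b) :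
    ent (coordLaw w hw c) id = ∑' x, coordLaw w hw c x * ENNReal.ofReal (∑ i, g (x i)) := by
  rw [ent_id]
  refine expect_congr fun x h0 => ?_
  rw [neg_log_coordLaw h0, Finset.sum_congr rfl fun i _ => hg _ _ (coordLaw_ne_zero.1 h0 i)]

theorem cEnt_coordLaw {w : Bool → Bool → ℝ≥0∞} {hw : ∀ a, w a true + w a false = 1}
    (μ : PMF (Fin n → Bool)) {g : Bool → ℝ}
    (hg : ∀ a b, w a b ≠ 0 → -Real.log (w a b).toReal = g a) :
    cEnt (extend μ (coordLaw w hw)) Prod.snd Prod.fst =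
      ∑' x, μ x * ENNReal.ofReal (∑ i, g (x i)) := by
  rw [cEnt_extend_snd, ← expect_extend_fst μ (coordLaw w hw)]
  refine expect_congr fun p hp => ?_
  have h0 := (extend_ne_zero.1 hp).2
  rw [neg_log_coordLaw h0, Finset.sum_congr rfl fun i _ => hg _ _ (coordLaw_ne_zero.1 h0 i)]

theorem expect_add_sum (μ : PMF (Fin n → Bool)) {f g : Bool → ℝ} (hf : ∀ b, 0 ≤ f b)
    (hg : ∀ b, 0 ≤ g b) : ∑' x, μ x * ENNReal.ofReal (∑ i, f (x i)) +
      ∑' x, μ x * ENNReal.ofReal (∑ i, g (x i)) =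
      ∑' x, μ x * ENNReal.ofReal (∑ i, (f (x i) + g (x i))) := by
  rw [← ENNReal.tsum_add]
  refine tsum_congr fun x => ?_
  rw [← mul_add, ← ENNReal.ofReal_add (Finset.sum_nonneg fun i _ => hf _)
    (Finset.sum_nonneg fun i _ => hg _), Finset.sum_add_distrib]

theorem expect_sum_const (μ : PMF (Fin n → Bool)) {f : Bool → ℝ} {c : ℝ} (hf : ∀ b, f b = c) :
    ∑' x, μ x * ENNReal.ofReal (∑ i, f (x i)) = ENNReal.ofReal (n * c) := by
  simp only [hf, Finset.sum_const, Finset.card_univ, Fintype.card_fin, nsmul_eq_mul]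
  exact expect_const μ _

/-- A fair bit. -/
def fairBit (_ _ : Bool) : ℝ≥0∞ := 2⁻¹

/-- A bit that is `1` with probability `1/3`. -/
def thirdBit (_ b : Bool) : ℝ≥0∞ := if b then 3⁻¹ else 2 * 3⁻¹

/-- A fair bit if `a = 1`, otherwise `c`. -/
def fairIf (c : Bool) (a b : Bool) : ℝ≥0∞ := if a then 2⁻¹ else if b = c then 1 else 0

/-- A fair bit if `a = 0`, otherwise `c`. -/
def fairUnless (c : Bool) (a b : Bool) : ℝ≥0∞ := if a then if b = c then 1 else 0 else 2⁻¹

theorem fairBit_add (a : Bool) : fairBit a true + fairBit a false = 1 :=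
  ENNReal.inv_two_add_inv_two

theorem thirdBit_add (a : Bool) : thirdBit a true + thirdBit a false = 1 := by
  simp only [thirdBit, if_true, Bool.false_eq_true, if_false]
  rw [show (3⁻¹ : ℝ≥0∞) + 2 * 3⁻¹ = 3 * 3⁻¹ by ring]
  exact ENNReal.mul_inv_cancel (by norm_num) (by norm_num)

theorem fairIf_add (c a : Bool) : fairIf c a true + fairIf c a false = 1 := by
  cases a <;> cases c <;> simp [fairIf, ENNReal.inv_two_add_inv_two]

theorem fairUnless_add (c a : Bool) : fairUnless c a true + fairUnless c a false = 1 := by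
  cases a <;> cases c <;> simp [fairUnless, ENNReal.inv_two_add_inv_two]

theorem neg_log_fairBit (a b : Bool) : -Real.log (fairBit a b).toReal = Real.log 2 := by
  simp [fairBit]

theorem neg_log_thirdBit (a b : Bool) :
    -Real.log (thirdBit a b).toReal = if b then Real.log 3 else Real.log 3 - Real.log 2 := by
  cases b
  · simp only [thirdBit, Bool.false_eq_true, if_false, ENNReal.toReal_mul, ENNReal.toReal_inv,
      ENNReal.toReal_ofNat]
    rw [Real.log_mul (by norm_num) (by norm_num), Real.log_inv]
    ring
  · simp [thirdBit]

theorem neg_log_fairIf (c : Bool) {a b : Bool} (h : fairIf c a b ≠ 0) :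
    -Real.log (fairIf c a b).toReal = if a then Real.log 2 else 0 := by
  cases a
  · have : b = c := by
      by_contra hb
      simp [fairIf, hb] at h
    simp [fairIf, this]
  · simp [fairIf]

theorem neg_log_fairUnless (c : Bool) {a b : Bool} (h : fairUnless c a b ≠ 0) :
    -Real.log (fairUnless c a b).toReal = if a then 0 else Real.log 2 := by
  cases a
  · simp [fairUnless]
  · have : b = c := by
      by_contra hb
      simp [fairUnless, hb] at h
    simp [fairUnless, this]

end ProductLaws

/-! ### Lower bounds on the entropy of the transcripts -/

section Bounds

variable {n : ℕ} {K : (Fin n → Bool) → (Fin n → Bool) → PMF Transcript}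

/-- M31 must carry Z even given M23, and given Z it must still hide Alice's input where Z does not
determine it: together with Bob's view it reveals that input, which Bob's view alone does not. -/
theorem PrivateAnd.le_ent_l31 (hK : PrivateAnd K) (x y : Fin n → Bool) :
    ENNReal.ofReal (n * Real.log 3) ≤ ent (K x y) Links.l31 := by
  -- `Z` has independent bits; in `ν₁` it is Alice's input, while in `ν₂` it is Bob's input
  set β : PMF (Fin n → Bool) := coordLaw thirdBit thirdBit_add fun _ => false with hβ
  set q : PMF ((Fin n → Bool) × (Fin n → Bool)) :=
    extend β (coordLaw (fairUnless true) (fairUnless_add true)) with hq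
  have hqsupp : ∀ p, q p ≠ 0 → bitAnd p.2 p.1 = p.1 := by
    intro p hp
    have h1 := coordLaw_ne_zero.1 (extend_ne_zero.1 hp).2
    funext i
    have h2 := h1 i
    cases hz : p.1 i
    · simp [hz]
    · rw [hz] at h2
      by_contra hb
      simp [bitAnd, hz] at hb
      simp [fairUnless, hb] at h2
  let κ₁ : (Fin n → Bool) → PMF Transcript := fun z => K z fun _ => true
  let κ₂ : (Fin n → Bool) × (Fin n → Bool) → PMF Transcript := fun p => K p.2 p.1
  set ν₁ := extend β κ₁ with hν₁
  set ν₂ := extend q κ₂ with hν₂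
  have hlaw : ∀ p, q p ≠ 0 → (κ₂ p).map (fun m => (m.l23, m.l31)) =
      (κ₁ p.1).map (fun m => (m.l23, m.l31)) := by
    intro p hp
    refine hK.charlie_law _ _ _ _ ?_
    rw [hqsupp p hp, bitAnd_true]
  have hbob : ∀ p p', p'.1 = p.1 → (κ₂ p').map (fun m => (m.l12, m.l23)) =
      (κ₂ p).map (fun m => (m.l12, m.l23)) := by
    intro p p' h
    have e := hK.bob_law p'.2 p.2 p'.1
    rw [show K p.2 p'.1 = K p.2 p.1 by rw [h]] at e
    exact e
  have h0 : ent (K x y) Links.l31 = ent ν₁ fun p => p.2.l31 := by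
    refine ent_eq_of_map_eq ?_
    rw [hν₁, map_extend_snd (F := Links.l31) (l := (K x y).map Links.l31)]
    exact fun z _ => hK.law31_eq _ _ _ _
  have h1 : cEnt ν₁ (fun p => p.2.l31) (fun p => p.2.l23) =
      cEnt ν₁ (fun p => p.1) (fun p => p.2.l23) +
        cEnt ν₁ (fun p => p.2.l31) (fun p => (p.1, p.2.l23)) := by
    rw [← cEnt_pair]
    refine cEnt_congr (by simp) ?_
    intro p p' hp hp'
    obtain ⟨ξ, hξ⟩ := hK.charlie_det
    have e1 := hξ _ _ _ ((PMF.mem_support_iff _ _).2 (extend_ne_zero.1 hp).2)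
    have e2 := hξ _ _ _ ((PMF.mem_support_iff _ _).2 (extend_ne_zero.1 hp').2)
    rw [bitAnd_true] at e1 e2
    simp only [Prod.mk.injEq]
    constructor
    · rintro ⟨h31, h23⟩
      rw [h31, h23, e1] at e2
      exact ⟨⟨h31, e2.symm⟩, h23⟩
    · rintro ⟨⟨h31, -⟩, h23⟩
      exact ⟨h31, h23⟩
  have h2 : cEnt ν₁ (fun p => p.1) (fun p => p.2.l23) = ent β id := by
    have h := cEnt_extend_fst_given (μ := β) (κ := κ₁) id Links.l23 (fun _ => ())
      fun z z' _ _ _ => hK.law23_eq _ _ _ _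
    rw [ent, ← h]
    exact cEnt_congr (by simp) (by simp)
  -- The change of input law: both experiments have the same output law, hence by Charlie's privacy
  -- the same joint law of Z, M23 and M31.
  have h3 : cEnt ν₁ (fun p => p.2.l31) (fun p => (p.1, p.2.l23)) =
      cEnt ν₂ (fun p => p.2.l31) (fun p => (p.1.1, p.2.l23)) := by
    have e1 := map_extend_eq (μ := β) (κ := κ₁) (F := fun m => (m.l23, m.l31)) (G := id)
      (l := fun z => (κ₁ z).map fun m => (m.l23, m.l31)) fun _ _ => rfl
    have e2 := map_extend_eq (μ := q) (κ := κ₂) (F := fun m => (m.l23, m.l31)) (G := Prod.fst)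
      (l := fun z => (κ₁ z).map fun m => (m.l23, m.l31)) hlaw
    rw [hq, extend_map_fst, ← hq] at e2
    rw [PMF.map_id, ← e2] at e1
    refine cEnt_eq_of_map_eq ?_
    have e3 := congrArg (PMF.map fun c : (Exchange × Exchange) × (Fin n → Bool) =>
      (c.1.2, (c.2, c.1.1))) e1
    rw [PMF.map_comp, PMF.map_comp] at e3
    exact e3
  -- Here Y = Z. Bob's view leaves H(X | Y) of uncertainty about X, while M12 and M31 determine X;
  -- so M31 given Bob's view has at least that entropy.
  have h4 : cEnt q Prod.snd Prod.fst ≤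
      cEnt ν₂ (fun p => p.2.l31) (fun p => (p.1.1, p.2.l23)) := by
    have e1 := cEnt_extend_fst_given (μ := q) (κ := κ₂) Prod.snd (fun m => (m.l12, m.l23)) Prod.fst
      fun p p' _ _ h => hbob p p' h
    rw [← e1]
    have e2 : cEnt ν₂ (fun p => p.1.2) (fun p => ((p.2.l12, p.2.l23), p.1.1)) ≤
        cEnt ν₂ (fun p => p.2.l31) (fun p => ((p.2.l12, p.2.l23), p.1.1)) := by
      refine cEnt_mono_left ?_
      intro p p' hp hp' h31 hC
      obtain ⟨ξ, hξ⟩ := hK.alice_det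
      have e1 := hξ _ _ _ ((PMF.mem_support_iff _ _).2 (extend_ne_zero.1 hp).2)
      have e2 := hξ _ _ _ ((PMF.mem_support_iff _ _).2 (extend_ne_zero.1 hp').2)
      simp only [Prod.mk.injEq] at hC
      rw [hC.1.1, h31, e1] at e2
      exact e2.symm
    have e3 : cEnt ν₂ (fun p => p.2.l31) (fun p => ((p.2.l12, p.2.l23), p.1.1)) ≤
        cEnt ν₂ (fun p => p.2.l31) (fun p => (p.1.1, p.2.l23)) := by
      refine cEnt_mono_right _ ?_
      intro p p' _ _ h
      simp only [Prod.mk.injEq] at h ⊢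
      exact ⟨h.2, h.1.2⟩
    exact e2.trans e3
  have hlog : Real.log 2 ≤ Real.log 3 := Real.log_le_log (by norm_num) (by norm_num)
  have hlog2 : 0 ≤ Real.log 2 := Real.log_nonneg (by norm_num)
  have hval : ent β id + cEnt q Prod.snd Prod.fst = ENNReal.ofReal (n * Real.log 3) := by
    have e1 : ent β id = ∑' z, β z * ENNReal.ofReal
        (∑ i, if z i then Real.log 3 else Real.log 3 - Real.log 2) :=
      ent_coordLaw _ fun a b _ => neg_log_thirdBit a b
    have e2 : cEnt q Prod.snd Prod.fst = ∑' z, β z * ENNReal.ofReal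
        (∑ i, if z i then 0 else Real.log 2) :=
      cEnt_coordLaw (hw := fairUnless_add true) β fun a b h => neg_log_fairUnless true h
    rw [e1, e2, expect_add_sum (f := fun b => if b then Real.log 3 else Real.log 3 - Real.log 2)
      (g := fun b => if b then 0 else Real.log 2), expect_sum_const
      (f := fun b => (if b then Real.log 3 else Real.log 3 - Real.log 2) +
        if b then 0 else Real.log 2)]
    · intro b
      cases b <;> simp
    · intro b
      cases b <;> simp <;> linarith
    · intro b
      cases b <;> simp [hlog2]
  calc ENNReal.ofReal (n * Real.log 3) = ent β id + cEnt q Prod.snd Prod.fst := hval.symm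
    _ ≤ cEnt ν₁ (fun p => p.2.l31) (fun p => p.2.l23) := by
        rw [h1, h2, h3]
        gcongr
    _ ≤ ent ν₁ fun p => p.2.l31 := cEnt_le_ent _ _ _
    _ = ent (K x y) Links.l31 := h0.symm

theorem PrivateAnd.le_ent_l23 (hK : PrivateAnd K) (x y : Fin n → Bool) :
    ENNReal.ofReal (n * Real.log 3) ≤ ent (K x y) Links.l23 := by
  have h := hK.swap.le_ent_l31 y x
  rw [ent_map] at h
  exact h

/-- The interaction inequality for the messages of the first `t` rounds, as recovered from the
final transcript. -/
theorem Protocol.interactionNonneg_decode {X Y Z : Type} (P : Protocol X Y Z) (q : PMF (X × Y))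
    (hfin : ent (extend q fun s => P.transcriptLaw s.1 s.2) (fun p => (p.1, p.2.l12)) ≠ ∞) (t : ℕ) :
    InteractionNonneg (extend q fun s => P.transcriptLaw s.1 s.2)
      (fun p => (p.1, (P.decode t p.2).l12)) (fun p => (P.decode t p.2).l31)
      (fun p => (P.decode t p.2).l23) := by
  have hmap : ∀ t, P.runLaw q t = (extend q fun s => P.transcriptLaw s.1 s.2).map
      fun p => (p.1, P.decode t p.2) := by
    intro t
    rw [NextMessage.runLaw, extend, extend, PMF.map_bind]
    congr 1
    funext s
    rw [← P.transcriptLaw_map_decode, PMF.map_comp, PMF.map_comp]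
    rfl
  have hfin' : ∀ t, ent (P.runLaw q t) (fun p => (p.1, p.2.l12)) ≠ ∞ := by
    intro t
    refine ne_top_of_le_ne_top hfin ?_
    rw [hmap, ent_map]
    refine cEnt_mono_left ?_
    intro p p' _ _ h _
    simp only [Prod.mk.injEq, Function.comp_apply, Protocol.decode] at h ⊢
    rw [h.1, h.2]
    exact ⟨rfl, rfl⟩
  have h := P.interactionNonneg_run q hfin' t
  rw [hmap] at h
  exact h.of_map _

theorem ent_extend_snd {α β : Type} {μ : PMF ((Fin n → Bool) × (Fin n → Bool))}
    {K : (Fin n → Bool) → (Fin n → Bool) → PMF α} {F : α → β}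
    (hF : ∀ x y x' y', (K x y).map F = (K x' y').map F) (x y : Fin n → Bool) :
    ent (extend μ fun s => K s.1 s.2) (fun p => F p.2) = ent (K x y) F := by
  refine ent_eq_of_map_eq ?_
  rw [map_extend_snd (F := F) (l := (K x y).map F)]
  exact fun s _ => hF _ _ _ _

/-- Consequences of the interaction inequality for links `U`, `V`, `W` and a secret `S`, a part
`Y` of which is shared by the links `W` and `U` on the one hand, `V` and `W` on the other. -/
theorem InteractionNonneg.ent_secret_le {Ω α β γ σ τ : Type} {ν : PMF Ω} {U : Ω → α} {V : Ω → β}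
    {W : Ω → γ} {S : Ω → σ} {Y : Ω → τ} (hJ : InteractionNonneg ν (pair U S) V W)
    (hSfin : ent ν S ≠ ∞) (hUfin : ent ν U ≠ ∞) (hY : ∀ ω ω', S ω' = S ω → Y ω' = Y ω)
    (hSV : cEnt ν S V = ent ν S) (hSW : cEnt ν S W = ent ν S)
    (hVW : cEnt ν S (pair (pair V W) Y) = cEnt ν S Y) (hUW : CondIndep ν U S (pair W Y)) :
    ent ν S + cEnt ν U (pair S V) ≤
      ent ν U + cEnt ν S (pair U (pair (pair V W) Y)) + cEnt ν Y (pair V W) := by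
  -- The chain rule splits S off every term of the interaction inequality, and one copy of H(S)
  -- cancels.
  have h1 : ent ν S + cEnt ν U (pair S V) + cEnt ν U (pair S W) ≤
      ent ν U + cEnt ν S (pair V W) + cEnt ν U (pair S (pair V W)) := by
    rw [InteractionNonneg, cEnt_pair ν U S, cEnt_pair ν U S, cEnt_pair ν U S, ent_pair ν U S, hSV,
      hSW] at hJ
    rw [← ENNReal.add_le_add_iff_right hSfin]
    calc _ = ent ν S + cEnt ν U (pair S V) + (ent ν S + cEnt ν U (pair S W)) := by ring
      _ ≤ ent ν S + cEnt ν U S + (cEnt ν S (pair V W) + cEnt ν U (pair S (pair V W))) := hJ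
      _ ≤ ent ν S + ent ν U + (cEnt ν S (pair V W) + cEnt ν U (pair S (pair V W))) := by
          gcongr
          exact cEnt_le_ent _ _ _
      _ = _ := by ring
  have h2 : cEnt ν S (pair V W) ≤ cEnt ν Y (pair V W) + cEnt ν S Y := by
    have e3 : cEnt ν S (pair Y (pair V W)) = cEnt ν S (pair (pair V W) Y) :=
      cEnt_congr (by simp [and_comm]) (by simp [and_comm])
    rw [← hVW, ← e3, ← cEnt_pair]
    exact cEnt_mono_left (by simp +contextual)
  -- The pair (U, S) given (V, W, Y) is expanded by the chain rule in both orders. The first term on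
  -- the right dominates H(U | V, W, Y), since H(U | S, W) = H(U | W, Y).
  have h3 : cEnt ν S Y + cEnt ν U (pair S (pair V W)) ≤
      cEnt ν U (pair S W) + cEnt ν S (pair U (pair (pair V W) Y)) := by
    have e3 : cEnt ν U (pair S W) = cEnt ν U (pair S (pair W Y)) := by
      refine cEnt_congr ?_ ?_ <;> intro ω ω' _ _ <;> have := hY ω ω' <;>
        simp only [Prod.mk.injEq] <;> tauto
    have e4 : cEnt ν U (pair S (pair V W)) = cEnt ν U (pair S (pair (pair V W) Y)) := by
      refine cEnt_congr ?_ ?_ <;> intro ω ω' _ _ <;> have := hY ω ω' <;>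
        simp only [Prod.mk.injEq] <;> tauto
    have e5 : cEnt ν (pair U S) (pair (pair V W) Y) = cEnt ν (pair S U) (pair (pair V W) Y) := by
      refine cEnt_congr ?_ ?_ <;> intro ω ω' _ _ <;> simp only [Prod.mk.injEq] <;> tauto
    rw [e3, hUW.cEnt_eq, e4, ← hVW, ← cEnt_pair ν U S, e5, cEnt_pair ν S U]
    refine add_le_add (cEnt_mono_right _ ?_) le_rfl
    intro ω ω' _ _
    simp only [Prod.mk.injEq]
    tauto
  have hne : cEnt ν S Y + cEnt ν U (pair S (pair V W)) + cEnt ν U (pair S W) ≠ ∞ :=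
    ENNReal.add_ne_top.2 ⟨ENNReal.add_ne_top.2 ⟨ne_top_of_le_ne_top hSfin (cEnt_le_ent _ _ _),
      ne_top_of_le_ne_top hUfin (cEnt_le_ent _ _ _)⟩,
      ne_top_of_le_ne_top hUfin (cEnt_le_ent _ _ _)⟩
  rw [← ENNReal.add_le_add_iff_right hne]
  calc _ = (ent ν S + cEnt ν U (pair S V) + cEnt ν U (pair S W)) +
        (cEnt ν S Y + cEnt ν U (pair S (pair V W))) := by ring
    _ ≤ (ent ν U + (cEnt ν Y (pair V W) + cEnt ν S Y) + cEnt ν U (pair S (pair V W))) +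
        (cEnt ν U (pair S W) + cEnt ν S (pair U (pair (pair V W) Y))) := by
        refine add_le_add (h1.trans ?_) h3
        gcongr
    _ = _ := by ring

end Bounds

/-! ### The link between Alice and Bob -/

section Bounds

variable {n : ℕ} {K : (Fin n → Bool) → (Fin n → Bool) → PMF Transcript}

/-- The interaction inequality when Bob's input is also the output, for functions of the links. -/
theorem PrivateAnd.ent_inputs_le (hK : PrivateAnd K)
    {q : PMF ((Fin n → Bool) × (Fin n → Bool))} (hq : ∀ s, q s ≠ 0 → bitAnd s.1 s.2 = s.2)
    (hqfin : ent q id ≠ ∞) {α β γ : Type} (dU : Exchange → α) (dV : Exchange → β)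
    (dW : Exchange → γ)
    (hfin : ent (extend q fun s => K s.1 s.2) (fun p => dU p.2.l12) ≠ ∞)
    (hJ : InteractionNonneg (extend q fun s => K s.1 s.2)
      (fun p => (p.1, dU p.2.l12)) (fun p => dV p.2.l31) (fun p => dW p.2.l23)) :
    ent q id + cEnt (extend q fun s => K s.1 s.2) (fun p => dU p.2.l12)
        (fun p => (p.1, dV p.2.l31)) ≤
      ent (extend q fun s => K s.1 s.2) (fun p => dU p.2.l12) +
        cEnt (extend q fun s => K s.1 s.2) (fun p => p.1.1) (fun p => (dU p.2.l12, dV p.2.l31)) +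
        cEnt (extend q fun s => K s.1 s.2) (fun p => p.1.2)
          (fun p => (dV p.2.l31, dW p.2.l23)) := by
  have hS : ent (extend q fun s => K s.1 s.2) (fun p => p.1) = ent q id := ent_extend_fst q _ id
  have hSV : cEnt (extend q fun s => K s.1 s.2) (fun p => p.1) (fun p => dV p.2.l31) =
      ent q id := by
    have h := cEnt_extend_fst_given (μ := q) (κ := fun s => K s.1 s.2) id (fun m => dV m.l31)
      (fun _ => ()) fun s s' _ _ _ =>
        PrivateAnd.map_comp_eq (hK.law31_eq s'.1 s'.2 s.1 s.2) dV
    rw [ent, ← h]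
    exact cEnt_congr (by simp) (by simp)
  have hSW : cEnt (extend q fun s => K s.1 s.2) (fun p => p.1) (fun p => dW p.2.l23) =
      ent q id := by
    have h := cEnt_extend_fst_given (μ := q) (κ := fun s => K s.1 s.2) id (fun m => dW m.l23)
      (fun _ => ()) fun s s' _ _ _ =>
        PrivateAnd.map_comp_eq (hK.law23_eq s'.1 s'.2 s.1 s.2) dW
    rw [ent, ← h]
    exact cEnt_congr (by simp) (by simp)
  -- Bob's input is the output here, so this is Charlie's privacy; the next independence is Bob's
  -- privacy.
  have hVW : cEnt (extend q fun s => K s.1 s.2) (fun p => p.1)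
      (fun p => ((dV p.2.l31, dW p.2.l23), p.1.2)) =
      cEnt (extend q fun s => K s.1 s.2) (fun p => p.1) (fun p => p.1.2) := by
    have h1 := cEnt_extend_fst_given (μ := q) (κ := fun s => K s.1 s.2) id
      (fun m => (dV m.l31, dW m.l23)) Prod.snd fun s s' h0 h0' h =>
        PrivateAnd.map_comp_eq (hK.charlie_law s'.1 s'.2 s.1 s.2
          (by rw [hq s h0, hq s' h0', h])) (fun c => (dV c.2, dW c.1))
    have h2 := cEnt_extend_fst q (fun s => K s.1 s.2) id Prod.snd
    exact h1.trans h2.symm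
  have hUW : CondIndep (extend q fun s => K s.1 s.2) (fun p => dU p.2.l12) (fun p => p.1)
      (fun p => (dW p.2.l23, p.1.2)) := by
    refine condIndep_extend' (μ := q) (D := Prod.snd) (fun m : Transcript => dU m.l12)
      (fun m => dW m.l23) id fun s s' _ _ h => ?_
    have e := PrivateAnd.map_comp_eq (hK.bob_law s'.1 s.1 s'.2) (Prod.map dU dW)
    have e' : K s.1 s'.2 = K s.1 s.2 := by rw [h]
    rw [e'] at e
    exact e
  have hJ' : InteractionNonneg (extend q fun s => K s.1 s.2)
      (pair (fun p => dU p.2.l12) fun p => p.1) (fun p => dV p.2.l31) (fun p => dW p.2.l23) :=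
    hJ.congr (by simp [and_comm]) (fun _ _ => Iff.rfl) (fun _ _ => Iff.rfl)
  have hX : cEnt (extend q fun s => K s.1 s.2) (fun p => p.1)
      (fun p => (dU p.2.l12, ((dV p.2.l31, dW p.2.l23), p.1.2))) ≤
      cEnt (extend q fun s => K s.1 s.2) (fun p => p.1.1)
        (fun p => (dU p.2.l12, dV p.2.l31)) := by
    have h1 : cEnt (extend q fun s => K s.1 s.2) (fun p => p.1)
        (fun p => (dU p.2.l12, ((dV p.2.l31, dW p.2.l23), p.1.2))) ≤
        cEnt (extend q fun s => K s.1 s.2) (fun p => p.1.1)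
          (fun p => (dU p.2.l12, ((dV p.2.l31, dW p.2.l23), p.1.2))) := by
      refine cEnt_mono_left ?_
      intro p p' _ _ h h'
      simp only [Prod.mk.injEq] at h'
      exact Prod.ext h h'.2.2
    refine h1.trans (cEnt_mono_right _ ?_)
    intro p p' _ _ h
    simp only [Prod.mk.injEq] at h ⊢
    exact ⟨h.1, h.2.1.1⟩
  have hSfin : ent (extend q fun s => K s.1 s.2) (fun p => p.1) ≠ ∞ := by rwa [hS]
  have h := InteractionNonneg.ent_secret_le (ν := extend q fun s => K s.1 s.2)
    (U := fun p => dU p.2.l12) (V := fun p => dV p.2.l31) (W := fun p => dW p.2.l23)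
    (S := fun p => p.1) (Y := fun p => p.1.2) hJ' hSfin hfin (fun p p' h => congrArg Prod.snd h)
    (hSV.trans hS.symm) (hSW.trans hS.symm) hVW hUW
  rw [hS] at h
  refine h.trans ?_
  exact add_le_add (add_le_add le_rfl hX) le_rfl

/-- For functions of the links: given Alice's view, her link with Bob must hide his input as long as
that input does not influence the output. -/
theorem PrivateAnd.cEnt_bob_input_le (hK : PrivateAnd K)
    {q : PMF ((Fin n → Bool) × (Fin n → Bool))}
    (hq : ∀ s, q s ≠ 0 → bitAnd s.1 s.2 = fun _ => false) {α β γ : Type} (dU : Exchange → α)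
    (dV : Exchange → β) (dW : Exchange → γ) :
    cEnt q Prod.snd Prod.fst ≤ cEnt (extend q fun s => K s.1 s.2) (fun p => dU p.2.l12)
        (fun p => (dV p.2.l31, p.1.1)) +
      cEnt (extend q fun s => K s.1 s.2) (fun p => p.1.2) (fun p => (dU p.2.l12, dW p.2.l23)) := by
  -- The output is constantly 0, so Charlie's view is independent of the inputs. Link `12` must then
  -- account for the uncertainty about Y, apart from the error of decoding Y from Bob's view.
  have h1 : cEnt (extend q fun s => K s.1 s.2) (fun p => p.1.2)
      (fun p => ((dV p.2.l31, dW p.2.l23), p.1.1)) = cEnt q Prod.snd Prod.fst :=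
    cEnt_extend_fst_given (μ := q) (κ := fun s => K s.1 s.2) Prod.snd
      (fun m => (dV m.l31, dW m.l23)) Prod.fst fun s s' h0 h0' _ =>
        PrivateAnd.map_comp_eq (hK.charlie_law s'.1 s'.2 s.1 s.2
          (by rw [hq s h0, hq s' h0'])) (fun c => (dV c.2, dW c.1))
  have h2 := cEnt_pair (extend q fun s => K s.1 s.2) (fun p => p.1.2) (fun p => dU p.2.l12)
    (fun p => ((dV p.2.l31, dW p.2.l23), p.1.1))
  have h3 : cEnt (extend q fun s => K s.1 s.2) (fun p => p.1.2)
      (fun p => ((dV p.2.l31, dW p.2.l23), p.1.1)) ≤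
      cEnt (extend q fun s => K s.1 s.2) (fun p => (p.1.2, dU p.2.l12))
        (fun p => ((dV p.2.l31, dW p.2.l23), p.1.1)) :=
    cEnt_mono_left fun p p' _ _ h _ => congrArg Prod.fst h
  have h4 : cEnt (extend q fun s => K s.1 s.2) (fun p => dU p.2.l12)
      (fun p => ((dV p.2.l31, dW p.2.l23), p.1.1)) ≤
      cEnt (extend q fun s => K s.1 s.2) (fun p => dU p.2.l12) (fun p => (dV p.2.l31, p.1.1)) := by
    refine cEnt_mono_right _ ?_
    intro p p' _ _ h
    simp only [Prod.mk.injEq] at h ⊢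
    exact ⟨h.1.1, h.2⟩
  have h5 : cEnt (extend q fun s => K s.1 s.2) (fun p => p.1.2)
      (fun p => (dU p.2.l12, ((dV p.2.l31, dW p.2.l23), p.1.1))) ≤
      cEnt (extend q fun s => K s.1 s.2) (fun p => p.1.2)
        (fun p => (dU p.2.l12, dW p.2.l23)) := by
    refine cEnt_mono_right _ ?_
    intro p p' _ _ h
    simp only [Prod.mk.injEq] at h ⊢
    exact ⟨h.1, h.2.1.2⟩
  rw [← h1]
  exact (h3.trans_eq h2).trans (add_le_add h4 h5)

/-- The entropy of the link between Alice and Bob, given Alice's view, depends only on the law of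
her input. -/
theorem PrivateAnd.cEnt_l12_eq (hK : PrivateAnd K) {q q' : PMF ((Fin n → Bool) × (Fin n → Bool))}
    (hq : q.map Prod.fst = q'.map Prod.fst) {α β : Type} (dU : Exchange → α)
    (dV : Exchange → β) :
    cEnt (extend q fun s => K s.1 s.2) (fun p => dU p.2.l12) (fun p => (p.1, dV p.2.l31)) =
      cEnt (extend q' fun s => K s.1 s.2) (fun p => dU p.2.l12)
        (fun p => (dV p.2.l31, p.1.1)) := by
  have hlaw : ∀ x y y', (K x y).map (fun m => (dU m.l12, dV m.l31)) =
      (K x y').map (fun m => (dU m.l12, dV m.l31)) := fun x y y' =>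
    PrivateAnd.map_comp_eq (hK.alice_law x y y') (Prod.map dU dV)
  have h1 : CondIndep (extend q fun s => K s.1 s.2) (fun p => dU p.2.l12) (fun p => p.1)
      (fun p => (dV p.2.l31, p.1.1)) := by
    -- Alice's privacy drops Bob's input from the condition; what remains involves only the law of X
    -- and Alice's view given X.
    refine condIndep_extend' (μ := q) (D := Prod.fst) (fun m : Transcript => dU m.l12)
      (fun m => dV m.l31) id fun s s' _ _ h => ?_
    have e := hlaw s'.1 s'.2 s.2
    have e' : K s'.1 s.2 = K s.1 s.2 := by rw [h]
    rw [e'] at e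
    exact e
  have h2 : cEnt (extend q fun s => K s.1 s.2) (fun p => dU p.2.l12)
      (fun p => (p.1, dV p.2.l31)) = cEnt (extend q fun s => K s.1 s.2) (fun p => dU p.2.l12)
      (pair (fun p => p.1) fun p => (dV p.2.l31, p.1.1)) := by
    refine cEnt_congr ?_ ?_
    all_goals
      intro p p' _ _
      simp only [Prod.ext_iff]
      tauto
  rw [h2, h1.cEnt_eq]
  have h3 : ∀ r : PMF ((Fin n → Bool) × (Fin n → Bool)),
      (extend r fun s => K s.1 s.2).map (fun p => ((dU p.2.l12, dV p.2.l31), p.1.1)) =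
      (extend (r.map Prod.fst) fun x => (K x fun _ => false).map
        fun m => (dU m.l12, dV m.l31)).map Prod.swap := fun r =>
    map_extend_eq (F := fun m : Transcript => (dU m.l12, dV m.l31)) (G := Prod.fst)
      (l := fun x => (K x fun _ => false).map fun m => (dU m.l12, dV m.l31))
      fun s _ => hlaw s.1 s.2 _
  have h4 := congrArg (PMF.map fun c : (α × β) × (Fin n → Bool) => (c.1.1, (c.1.2, c.2)))
    ((h3 q).trans ((by rw [hq] : _ = _).trans (h3 q').symm))
  rw [PMF.map_comp, PMF.map_comp] at h4
  exact cEnt_eq_of_map_eq h4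

theorem Protocol.eventually_concat_decode {X Y Z : Type} (P : Protocol X Y Z)
    {q : PMF (X × Y)} {p : (X × Y) × Transcript}
    (hp : extend q (fun s => P.transcriptLaw s.1 s.2) p ≠ 0) : ∀ᶠ t in Filter.atTop,
      LinkHistory.concat (P.code.l12.decode t p.2.l12) = p.2.l12 ∧
      LinkHistory.concat (P.code.l23.decode t p.2.l23) = p.2.l23 ∧
      LinkHistory.concat (P.code.l31.decode t p.2.l31) = p.2.l31 := by
  have hm := (PMF.mem_support_iff _ _).2 (extend_ne_zero.1 hp).2
  filter_upwards [P.eventually_transcript_decode hm] with t ht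
  exact ⟨congrArg Links.l12 ht, congrArg Links.l23 ht, congrArg Links.l31 ht⟩

/-- The bound on the link between Alice and Bob. -/
theorem Protocol.le_ent_l12 {P : Protocol (Fin n → Bool) (Fin n → Bool) (Fin n → Bool)}
    (hK : PrivateAnd P.transcriptLaw) (x y : Fin n → Bool) :
    ENNReal.ofReal (n * (2 * Real.log 2)) ≤ ent (P.transcriptLaw x y) Links.l12 := by
  -- The cancellations in the interaction inequality need finite entropy on link `12`; no such
  -- assumption is made about the links to Charlie.
  by_cases hfin : ent (P.transcriptLaw x y) Links.l12 = ∞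
  · rw [hfin]
    exact le_top
  -- X is uniform in both laws. Under `q` Bob's bit is fair where x = 1 and 0 elsewhere, so the
  -- output equals Y; under `q'` it is fair where x = 0 and 0 elsewhere, so the output is 0. Each
  -- coordinate contributes log 2 from X and a further log 2 from exactly one of the two laws of Y.
  set α : PMF (Fin n → Bool) := coordLaw fairBit fairBit_add fun _ => false with hα
  set q : PMF ((Fin n → Bool) × (Fin n → Bool)) :=
    extend α (coordLaw (fairIf false) (fairIf_add false)) with hq
  set q' : PMF ((Fin n → Bool) × (Fin n → Bool)) :=
    extend α (coordLaw (fairUnless false) (fairUnless_add false)) with hq'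
  have hqsupp : ∀ s, q s ≠ 0 → bitAnd s.1 s.2 = s.2 := by
    intro s hs
    have h1 := coordLaw_ne_zero.1 (extend_ne_zero.1 hs).2
    funext i
    have h2 := h1 i
    change (s.1 i && s.2 i) = s.2 i
    revert h2
    cases s.1 i <;> cases s.2 i <;> simp [fairIf]
  have hqsupp' : ∀ s, q' s ≠ 0 → bitAnd s.1 s.2 = fun _ => false := by
    intro s hs
    have h1 := coordLaw_ne_zero.1 (extend_ne_zero.1 hs).2
    funext i
    have h2 := h1 i
    change (s.1 i && s.2 i) = false
    revert h2
    cases s.1 i <;> cases s.2 i <;> simp [fairUnless]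
  have hlog2 : 0 ≤ Real.log 2 := Real.log_nonneg (by norm_num)
  -- the entropies of the inputs
  have e1 : ent α id = ∑' x, α x * ENNReal.ofReal (∑ _i : Fin n, Real.log 2) :=
    ent_coordLaw (g := fun _ => Real.log 2) _ fun a b _ => neg_log_fairBit a b
  have e2 : cEnt q Prod.snd Prod.fst = ∑' x, α x * ENNReal.ofReal
      (∑ i, if x i then Real.log 2 else 0) :=
    cEnt_coordLaw (hw := fairIf_add false) α fun a b h => neg_log_fairIf false h
  have e3 : cEnt q' Prod.snd Prod.fst = ∑' x, α x * ENNReal.ofReal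
      (∑ i, if x i then 0 else Real.log 2) :=
    cEnt_coordLaw (hw := fairUnless_add false) α fun a b h => neg_log_fairUnless false h
  have e4 : ent q id = ent α id + cEnt q Prod.snd Prod.fst := by
    have h1 : ent q (pair Prod.snd Prod.fst) = ent q id :=
      cEnt_congr (by simp) (by simp [Prod.ext_iff, and_comm])
    have h2 : ent q Prod.fst = ent α id := ent_extend_fst α _ id
    rw [← h1, ent_pair, h2]
  have hval : ent q id + cEnt q' Prod.snd Prod.fst = ENNReal.ofReal (n * (2 * Real.log 2)) := by
    rw [e4, e1, e2, e3, add_assoc, expect_add_sum (f := fun b => if b then Real.log 2 else 0)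
      (g := fun b => if b then 0 else Real.log 2), expect_add_sum (f := fun _ => Real.log 2)
      (g := fun b => (if b then Real.log 2 else 0) + if b then 0 else Real.log 2),
      expect_sum_const (f := fun b => Real.log 2 +
        ((if b then Real.log 2 else 0) + if b then 0 else Real.log 2)) (c := 2 * Real.log 2)]
    · intro b
      cases b <;> simp <;> ring
    · exact fun _ => hlog2
    · intro b
      cases b <;> simp [hlog2]
    · intro b
      cases b <;> simp [hlog2]
    · intro b
      cases b <;> simp [hlog2]
  have hqfin : ent q id ≠ ∞ :=
    ne_top_of_le_ne_top ENNReal.ofReal_ne_top (hval ▸ le_self_add)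
  -- the entropy of the transcript
  set ν := extend q fun s => P.transcriptLaw s.1 s.2 with hν
  set ν' := extend q' fun s => P.transcriptLaw s.1 s.2 with hν'
  have hU : ent ν (fun p => p.2.l12) = ent (P.transcriptLaw x y) Links.l12 :=
    ent_extend_snd (K := P.transcriptLaw) hK.law12_eq x y
  have hUS : ent ν (fun p => (p.1, p.2.l12)) ≠ ∞ := by
    have h1 : ent ν (fun p => (p.1, p.2.l12)) = ent ν (fun p => p.2.l12) +
        cEnt ν (fun p => p.1) (fun p => p.2.l12) := ent_pair ν (fun p => p.1) fun p => p.2.l12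
    have h2 : ent ν (fun p => p.1) = ent q id := ent_extend_fst q _ id
    rw [h1, hU]
    exact ENNReal.add_ne_top.2 ⟨hfin, ne_top_of_le_ne_top (h2 ▸ hqfin) (cEnt_le_ent _ _ _)⟩
  have hUt : ∀ t, ent ν (fun p => P.code.l12.decode t p.2.l12) ≤
      ent (P.transcriptLaw x y) Links.l12 := fun t =>
    hU ▸ cEnt_mono_left fun p p' _ _ h _ => congrArg _ h
  -- The three last terms are the errors in decoding X from Alice's view, the output Y from
  -- Charlie's view, and Y from Bob's view after t rounds.
  have hbound : ∀ t, ent q id + cEnt q' Prod.snd Prod.fst ≤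
      ent (P.transcriptLaw x y) Links.l12 +
        (cEnt ν (fun p => p.1.1)
            (fun p => (P.code.l12.decode t p.2.l12, P.code.l31.decode t p.2.l31)) +
          cEnt ν (fun p => p.1.2)
            (fun p => (P.code.l31.decode t p.2.l31, P.code.l23.decode t p.2.l23)) +
          cEnt ν' (fun p => p.1.2)
            (fun p => (P.code.l12.decode t p.2.l12, P.code.l23.decode t p.2.l23))) := by
    intro t
    have h1 := hK.ent_inputs_le hqsupp hqfin (P.code.l12.decode t) (P.code.l31.decode t)
      (P.code.l23.decode t) (ne_top_of_le_ne_top hfin (hUt t)) (P.interactionNonneg_decode q hUS t)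
    have h2 := hK.cEnt_bob_input_le hqsupp' (P.code.l12.decode t) (P.code.l31.decode t)
      (P.code.l23.decode t)
    have h3 := hK.cEnt_l12_eq (q := q) (q' := q') (by rw [hq, hq', extend_map_fst, extend_map_fst])
      (P.code.l12.decode t) (P.code.l31.decode t)
    rw [← h3] at h2
    calc _ ≤ _ := add_le_add_right h2 _
      _ = _ := (add_assoc _ _ _).symm
      _ ≤ _ := add_le_add_left h1 _
      _ ≤ _ := by
        rw [add_assoc, add_assoc, ← add_assoc (cEnt _ _ _)]
        exact add_le_add_left (hUt t) _
  -- the error terms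
  obtain ⟨ξA, hξA⟩ := hK.alice_det
  obtain ⟨ξB, hξB⟩ := hK.bob_det
  obtain ⟨ξC, hξC⟩ := hK.charlie_det
  have l1 := tendsto_cEnt_of_eventually_guess ν (fun p => p.1.1)
    (fun t p => (P.code.l12.decode t p.2.l12, P.code.l31.decode t p.2.l31))
    (fun _ c => ξA (LinkHistory.concat c.1) (LinkHistory.concat c.2)) fun p hp => by
      filter_upwards [P.eventually_concat_decode hp] with t ht
      rw [ht.1, ht.2.2]
      exact hξA _ _ _ ((PMF.mem_support_iff _ _).2 (extend_ne_zero.1 hp).2)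
  have l2 := tendsto_cEnt_of_eventually_guess ν (fun p => p.1.2)
    (fun t p => (P.code.l31.decode t p.2.l31, P.code.l23.decode t p.2.l23))
    (fun _ c => ξC (LinkHistory.concat c.2) (LinkHistory.concat c.1)) fun p hp => by
      filter_upwards [P.eventually_concat_decode hp] with t ht
      rw [ht.2.1, ht.2.2, hξC _ _ _ ((PMF.mem_support_iff _ _).2 (extend_ne_zero.1 hp).2)]
      exact hqsupp _ (extend_ne_zero.1 hp).1
  have l3 := tendsto_cEnt_of_eventually_guess ν' (fun p => p.1.2)
    (fun t p => (P.code.l12.decode t p.2.l12, P.code.l23.decode t p.2.l23))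
    (fun _ c => ξB (LinkHistory.concat c.1) (LinkHistory.concat c.2)) fun p hp => by
      filter_upwards [P.eventually_concat_decode hp] with t ht
      rw [ht.1, ht.2.1]
      exact hξB _ _ _ ((PMF.mem_support_iff _ _).2 (extend_ne_zero.1 hp).2)
  -- Only the error terms pass to the limit; the entropy of the full transcript already bounds that
  -- of its truncations.
  have hlim := (tendsto_const_nhds (x := ent (P.transcriptLaw x y) Links.l12)).add
    ((l1.add l2).add l3)
  rw [← hval]
  simpa using ge_of_tendsto' hlim hbound

end Bounds

/-! ### Entropies in bits -/

section Bits

variable {Ω α β : Type}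

theorem ofReal_mul_div_log_two {p : ℝ≥0∞} (hp : p ≠ ∞) (r : ℝ) :
    ENNReal.ofReal (p.toReal * (r / Real.log 2)) =
      p * ENNReal.ofReal r * (ENNReal.ofReal (Real.log 2))⁻¹ := by
  rw [ENNReal.ofReal_mul ENNReal.toReal_nonneg, ENNReal.ofReal_toReal hp,
    ENNReal.ofReal_div_of_pos (Real.log_pos (by norm_num)), div_eq_mul_inv, mul_assoc]

theorem condEntropy_eq (μ : PMF Ω) (T : Ω → α) (C : Ω → β) :
    condEntropy μ T C = cEnt μ T C * (ENNReal.ofReal (Real.log 2))⁻¹ := by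
  have h1 : cEnt μ T C = ∑' c : α × β, μ.map (pair T C) c * ENNReal.ofReal
      (Real.log (μ.map C c.2).toReal - Real.log (μ.map (pair T C) c).toReal) :=
    (tsum_map_mul μ (pair T C) fun c => ENNReal.ofReal
      (Real.log (μ.map C c.2).toReal - Real.log (μ.map (pair T C) c).toReal)).symm
  rw [h1, condEntropy, ← ENNReal.tsum_mul_right]
  refine tsum_congr fun c => ?_
  rw [← ofReal_mul_div_log_two (PMF.apply_ne_top _ _)]
  by_cases h0 : μ.map (pair T C) c = 0
  · rw [h0]
    simp
  · obtain ⟨ω, hω, rfl⟩ := (PMF.mem_support_map_iff _ _ _).1 ((PMF.mem_support_iff _ _).2 h0)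
    have h2 : μ.map C (pair T C ω).2 ≠ 0 := fiberProb_ne_zero C ((PMF.mem_support_iff _ _).1 hω)
    rw [Real.logb, Real.log_div (ENNReal.toReal_pos h2 (PMF.apply_ne_top _ _)).ne'
      (ENNReal.toReal_pos h0 (PMF.apply_ne_top _ _)).ne']

theorem entropy_eq (μ : PMF Ω) (T : Ω → α) :
    entropy μ T = ent μ T * (ENNReal.ofReal (Real.log 2))⁻¹ := by
  have h1 : ent μ T = ∑' t, μ.map T t * ENNReal.ofReal (-Real.log (μ.map T t).toReal) := by
    have h2 := ent_map μ T id
    rw [ent_id] at h2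
    exact h2.symm
  rw [h1, entropy, ← ENNReal.tsum_mul_right]
  refine tsum_congr fun t => ?_
  rw [← ofReal_mul_div_log_two (PMF.apply_ne_top _ _), Real.negMulLog]
  congr 1
  ring

theorem ofReal_le_of_nats {c : ℝ} {e : ℝ≥0∞} (h : ENNReal.ofReal (c * Real.log 2) ≤ e) :
    ENNReal.ofReal c ≤ e * (ENNReal.ofReal (Real.log 2))⁻¹ := by
  have hpos : 0 < Real.log 2 := Real.log_pos (by norm_num)
  rw [← div_eq_mul_inv, ENNReal.le_div_iff_mul_le (Or.inl (ENNReal.ofReal_pos.2 hpos).ne')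
    (Or.inl ENNReal.ofReal_ne_top), ← ENNReal.ofReal_mul' hpos.le]
  exact h

end Bits

/-! ### Bounds in bits for secure protocols -/

section SecureBounds

variable {n : ℕ} {P : Protocol (Fin n → Bool) (Fin n → Bool) (Fin n → Bool)}
  {pXY : PMF ((Fin n → Bool) × (Fin n → Bool))}

theorem Protocol.Secure.ent_link_eq {α : Type} (hP : P.Secure pXY (andFn n))
    (hfull : ∀ xy, pXY xy ≠ 0) (F : Transcript → α)
    (hF : ∀ x y x' y', (P.transcriptLaw x y).map F = (P.transcriptLaw x' y').map F) :
    ent (P.law pXY) (fun ω => F ω.m) =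
      ent (P.transcriptLaw (fun _ => false) fun _ => false) F := by
  rw [hP.law_eq hfull, ent_map]
  exact ent_extend_snd (K := P.transcriptLaw) hF _ _

theorem Protocol.Secure.le_entropy_M31 (hP : P.Secure pXY (andFn n)) (hfull : ∀ xy, pXY xy ≠ 0) :
    ENNReal.ofReal (n * Real.logb 2 3) ≤ entropy (P.law pXY) Outcome.M31 := by
  have hK := hP.privateAnd hfull
  have hpos : 0 < Real.log 2 := Real.log_pos (by norm_num)
  have h1 : ent (P.law pXY) Outcome.M31 = _ := hP.ent_link_eq hfull Links.l31 hK.law31_eq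
  rw [entropy_eq, h1]
  refine ofReal_le_of_nats ?_
  rw [mul_assoc, Real.logb, div_mul_cancel₀ _ hpos.ne']
  exact hK.le_ent_l31 _ _

theorem Protocol.Secure.le_entropy_M23 (hP : P.Secure pXY (andFn n)) (hfull : ∀ xy, pXY xy ≠ 0) :
    ENNReal.ofReal (n * Real.logb 2 3) ≤ entropy (P.law pXY) Outcome.M23 := by
  have hK := hP.privateAnd hfull
  have hpos : 0 < Real.log 2 := Real.log_pos (by norm_num)
  have h1 : ent (P.law pXY) Outcome.M23 = _ := hP.ent_link_eq hfull Links.l23 hK.law23_eq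
  rw [entropy_eq, h1]
  refine ofReal_le_of_nats ?_
  rw [mul_assoc, Real.logb, div_mul_cancel₀ _ hpos.ne']
  exact hK.le_ent_l23 _ _

theorem Protocol.Secure.le_ent_M12 (hP : P.Secure pXY (andFn n)) (hfull : ∀ xy, pXY xy ≠ 0) :
    ENNReal.ofReal (n * 2 * Real.log 2) ≤ ent (P.law pXY) Outcome.M12 := by
  have hK := hP.privateAnd hfull
  have h1 : ent (P.law pXY) Outcome.M12 = _ := hP.ent_link_eq hfull Links.l12 hK.law12_eq
  rw [h1, mul_assoc]
  exact Protocol.le_ent_l12 hK _ _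

theorem Protocol.Secure.le_entropy_M12 (hP : P.Secure pXY (andFn n)) (hfull : ∀ xy, pXY xy ≠ 0) :
    ENNReal.ofReal (n * 2) ≤ entropy (P.law pXY) Outcome.M12 := by
  rw [entropy_eq]
  exact ofReal_le_of_nats (hP.le_ent_M12 hfull)

/-- The views determine the transcript between Alice and Bob, which is independent of the
inputs. -/
theorem Protocol.Secure.le_condEntropy_views (hP : P.Secure pXY (andFn n))
    (hfull : ∀ xy, pXY xy ≠ 0) : ENNReal.ofReal (n * 2) ≤
      condEntropy (P.law pXY) (fun ω => (ω.V1, ω.V2, ω.V3)) fun ω => (ω.x, ω.y) := by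
  have hK := hP.privateAnd hfull
  rw [condEntropy_eq]
  refine ofReal_le_of_nats ((hP.le_ent_M12 hfull).trans ?_)
  have h1 : CondIndep (extend pXY fun s => P.transcriptLaw s.1 s.2) (fun p => p.2.l12)
      (fun p => p.1) (fun _ => ()) :=
    condIndep_extend (μ := pXY) (κ := fun s => P.transcriptLaw s.1 s.2) Links.l12 id
      (D := fun _ => ()) fun s s' _ _ _ => hK.law12_eq _ _ _ _
  have h2 : ent (P.law pXY) Outcome.M12 = cEnt (P.law pXY) Outcome.M12 fun ω => (ω.x, ω.y) := by
    rw [hP.law_eq hfull, ent_map, cEnt_map]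
    refine h1.cEnt_eq.symm.trans (cEnt_congr ?_ ?_)
    all_goals
      intro p p' _ _
      simp [Outcome.M12, Prod.ext_iff]
  rw [h2]
  refine cEnt_mono_left ?_
  intro ω ω' _ _ h _
  simp only [Outcome.V1, Outcome.V2, Outcome.V3, Outcome.M1, Prod.mk.injEq] at h
  exact h.1.1.1

end SecureBounds

/-! ### A correlated multi-secret sharing scheme for AND -/

section Sharing

/-- The shares, computed from the bits `x`, `y` and from the dealer's randomness: the shares `12`
and `31` agree if and only if `x = 1`, the shares `12` and `23` agree if and only if `y = 1`. -/
def andShares (x y : Bool) (r : Fin 3 × Bool) : Fin 3 × Fin 3 × Fin 3 :=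
  (r.1, r.1 - bif y then 0 else bif r.2 then 1 else 2,
    r.1 + bif x then 0 else bif r.2 then 1 else 2)

/-- The dealer of the sharing scheme. -/
def andDealer (x y _z : Bool) : PMF (Fin 3 × Fin 3 × Fin 3) :=
  (PMF.uniformOfFintype (Fin 3 × Bool)).map (andShares x y)

/-- Secrets and shares as a function of the input bits and of the randomness. -/
def andSharing (ω : (Bool × Bool) × (Fin 3 × Bool)) : Sharing Bool Bool Bool (Fin 3) (Fin 3)
    (Fin 3) :=
  ⟨ω.1.1, ω.1.2, ω.1.1 && ω.1.2, (andShares ω.1.1 ω.1.2 ω.2).1, (andShares ω.1.1 ω.1.2 ω.2).2.1,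
    (andShares ω.1.1 ω.1.2 ω.2).2.2⟩

theorem sharingLaw_andDealer : sharingLaw uniformAnd andDealer =
    (PMF.uniformOfFintype ((Bool × Bool) × (Fin 3 × Bool))).map andSharing := by
  have h1 : extend (PMF.uniformOfFintype (Bool × Bool))
      (fun _ => PMF.uniformOfFintype (Fin 3 × Bool)) = PMF.uniformOfFintype _ := by
    refine PMF.ext fun ω => ?_
    rw [extend_apply, PMF.uniformOfFintype_apply, PMF.uniformOfFintype_apply,
      PMF.uniformOfFintype_apply, Fintype.card_prod (Bool × Bool), Nat.cast_mul,
      ENNReal.mul_inv (by simp) (by simp)]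
  rw [← h1, sharingLaw, uniformAnd, extend, PMF.bind_map, PMF.map_bind]
  congr 1
  funext b
  rw [PMF.map_comp, Function.comp_apply, andDealer, PMF.map_comp]
  rfl

theorem uniformOfFintype_map_apply {Ω α : Type} [Fintype Ω] [Nonempty Ω] [DecidableEq α]
    (f : Ω → α) (a : α) : (PMF.uniformOfFintype Ω).map f a =
      (Finset.univ.filter fun ω => a = f ω).card * (Fintype.card Ω : ℝ≥0∞)⁻¹ := by
  classical
  rw [PMF.map_apply, tsum_fintype]
  simp only [PMF.uniformOfFintype_apply, Finset.sum_ite, Finset.sum_const, nsmul_eq_mul, mul_zero,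
    add_zero]

theorem markovChain_uniformOfFintype {Ω α β γ : Type} [Fintype Ω] [Nonempty Ω] [DecidableEq α]
    [DecidableEq β] [DecidableEq γ] {T : Ω → α} {U : Ω → β} {V : Ω → γ}
    (h : ∀ t u v, (Finset.univ.filter fun ω => (t, u, v) = (T ω, U ω, V ω)).card *
        (Finset.univ.filter fun ω => u = U ω).card =
      (Finset.univ.filter fun ω => (t, u) = (T ω, U ω)).card *
        (Finset.univ.filter fun ω => (u, v) = (U ω, V ω)).card) :
    MarkovChain (PMF.uniformOfFintype Ω) T U V := by
  intro t u v
  simp only [uniformOfFintype_map_apply]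
  have h1 := congrArg (Nat.cast : ℕ → ℝ≥0∞) (h t u v)
  push_cast at h1
  calc _ = _ * ((Fintype.card Ω : ℝ≥0∞)⁻¹ * (Fintype.card Ω : ℝ≥0∞)⁻¹) :=
        mul_mul_mul_comm _ _ _ _
    _ = _ := by rw [h1, mul_mul_mul_comm]

theorem entropy_of_uniform_share {Ω : Type} {μ : PMF Ω} {T : Ω → Fin 3}
    (h : ∀ t, μ.map T t = 3⁻¹) : entropy μ T = ENNReal.ofReal (Real.logb 2 3) := by
  have h1 : Real.negMulLog ((3⁻¹ : ℝ≥0∞)).toReal / Real.log 2 = 3⁻¹ * Real.logb 2 3 := by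
    rw [Real.negMulLog, ENNReal.toReal_inv, ENNReal.toReal_ofNat, Real.log_inv, Real.logb]
    ring
  rw [entropy]
  simp only [h, h1, tsum_fintype, Finset.sum_const, Finset.card_univ, Fintype.card_fin]
  rw [ENNReal.ofReal_mul (by norm_num), nsmul_eq_mul, ← mul_assoc,
    ENNReal.ofReal_inv_of_pos (by norm_num), ENNReal.ofReal_ofNat, Nat.cast_ofNat,
    ENNReal.mul_inv_cancel (by norm_num) (by norm_num), one_mul]

theorem map_share_apply {T : (Bool × Bool) × (Fin 3 × Bool) → Fin 3}
    (h : ∀ t, (Finset.univ.filter fun ω => t = T ω).card = 8) (t : Fin 3) :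
    (PMF.uniformOfFintype ((Bool × Bool) × (Fin 3 × Bool))).map T t = 3⁻¹ := by
  rw [uniformOfFintype_map_apply, h]
  have h1 : (Fintype.card ((Bool × Bool) × (Fin 3 × Bool)) : ℝ≥0∞) = 8 * 3 := by
    simp only [Fintype.card_prod, Fintype.card_bool, Fintype.card_fin]
    norm_num
  rw [h1, ENNReal.mul_inv (by norm_num) (by norm_num), ← mul_assoc, Nat.cast_ofNat,
    ENNReal.mul_inv_cancel (by norm_num) (by norm_num), one_mul]

theorem condEntropy_eq_zero {Ω α β : Type} {μ : PMF Ω} {T : Ω → α} {C : Ω → β}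
    (h : ∀ ω ω', C ω' = C ω → T ω' = T ω) : condEntropy μ T C = 0 := by
  rw [condEntropy_eq, cEnt_eq_zero fun ω ω' _ _ => h ω ω', zero_mul]

theorem condEntropy_map {Ω Ω' α β : Type} (μ : PMF Ω) (f : Ω → Ω') (T : Ω' → α) (C : Ω' → β) :
    condEntropy (μ.map f) T C = condEntropy μ (T ∘ f) (C ∘ f) := by
  rw [condEntropy_eq, condEntropy_eq, cEnt_map]

-- With s uniform modulo 3 and d uniform in {1, 2}, the shares are s, s - d or s, and s + d or s.
-- The opposite signs make shares `23` and `31` differ by d or by 2d = -d unless x = y = 1, so they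
-- agree exactly when the AND is 1. Each party sees a uniform pair of equal values if its bit is 1
-- and a uniform pair of distinct values if it is 0, whatever the other secrets.
set_option maxRecDepth 100000 in
theorem isCMSS_andDealer : IsCMSS uniformAnd andDealer := by
  refine ⟨?_, ?_, ?_, ?_, ?_, ?_⟩ <;> rw [sharingLaw_andDealer]
  · rw [condEntropy_map]
    exact condEntropy_eq_zero (by simp only [Function.comp_apply, andSharing]; decide)
  · rw [condEntropy_map]
    exact condEntropy_eq_zero (by simp only [Function.comp_apply, andSharing]; decide)
  · rw [condEntropy_map]
    exact condEntropy_eq_zero (by simp only [Function.comp_apply, andSharing]; decide)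
  · rw [markovChain_map]
    exact markovChain_uniformOfFintype
      (by simp only [Function.comp_apply, andSharing]; decide +kernel)
  · rw [markovChain_map]
    exact markovChain_uniformOfFintype
      (by simp only [Function.comp_apply, andSharing]; decide +kernel)
  · rw [markovChain_map]
    exact markovChain_uniformOfFintype
      (by simp only [Function.comp_apply, andSharing]; decide +kernel)

theorem entropy_andShares {T : Sharing Bool Bool Bool (Fin 3) (Fin 3) (Fin 3) → Fin 3}
    (h : ∀ t, (Finset.univ.filter fun ω => t = T (andSharing ω)).card = 8) :
    entropy (sharingLaw uniformAnd andDealer) T = ENNReal.ofReal (Real.logb 2 3) := by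
  refine entropy_of_uniform_share fun t => ?_
  rw [sharingLaw_andDealer, PMF.map_comp]
  exact map_share_apply h t

end Sharing

theorem logb_two_three_lt : Real.logb 2 3 < 1.826 := by
  rw [Real.logb_lt_iff_lt_rpow (by norm_num) (by norm_num)]
  -- From 3 ^ 5 = 243 < 256 = 2 ^ 8 one gets log 3 < 8 / 5.
  calc (3 : ℝ) = (3 ^ 5 : ℝ) ^ (1 / 5 : ℝ) := by
        rw [← Real.rpow_natCast, ← Real.rpow_mul (by norm_num)]
        norm_num
    _ < (2 ^ 8 : ℝ) ^ (1 / 5 : ℝ) := Real.rpow_lt_rpow (by norm_num) (by norm_num) (by norm_num)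
    _ = 2 ^ (8 / 5 : ℝ) := by
        rw [← Real.rpow_natCast, ← Real.rpow_mul (by norm_num)]
        norm_num
    _ ≤ 2 ^ (1.826 : ℝ) := Real.rpow_le_rpow_of_exponent_le (by norm_num) (by norm_num)

theorem mainTheorem8 :
    (∀ (n : ℕ) (pXY : PMF ((Fin n → Bool) × (Fin n → Bool))), (∀ xy, pXY xy ≠ 0) →
      (∀ P : Protocol (Fin n → Bool) (Fin n → Bool) (Fin n → Bool),
        P.Secure pXY (andFn n) →
          ENNReal.ofReal (n * Real.logb 2 3) ≤ entropy (P.law pXY) Outcome.M31 ∧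
          ENNReal.ofReal (n * Real.logb 2 3) ≤ entropy (P.law pXY) Outcome.M23 ∧
          ENNReal.ofReal (n * 1.826) ≤ entropy (P.law pXY) Outcome.M12) ∧
      ENNReal.ofReal (n * 1.826) ≤ randomness pXY (andFn n)) ∧
    (∃ (S₁₂ S₂₃ S₃₁ : Type) (σ : Bool → Bool → Bool → PMF (S₁₂ × S₂₃ × S₃₁)),
      IsCMSS uniformAnd σ ∧
      entropy (sharingLaw uniformAnd σ) (fun ω => ω.m12) = ENNReal.ofReal (Real.logb 2 3) ∧
      entropy (sharingLaw uniformAnd σ) (fun ω => ω.m23) = ENNReal.ofReal (Real.logb 2 3) ∧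
      entropy (sharingLaw uniformAnd σ) (fun ω => ω.m31) = ENNReal.ofReal (Real.logb 2 3)) ∧
    Real.logb 2 3 < 1.826 := by
  -- The bounds on link `12` and on the randomness were proved with the larger constant 2.
  have hle : ∀ n : ℕ, ENNReal.ofReal (n * 1.826) ≤ ENNReal.ofReal (n * 2) := fun n =>
    ENNReal.ofReal_le_ofReal (mul_le_mul_of_nonneg_left (by norm_num) n.cast_nonneg)
  refine ⟨fun n pXY hfull => ⟨fun P hP => ⟨hP.le_entropy_M31 hfull, hP.le_entropy_M23 hfull,
    (hle n).trans (hP.le_entropy_M12 hfull)⟩, le_iInf₂ fun P hP =>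
      (hle n).trans (hP.le_condEntropy_views hfull)⟩,
    ⟨Fin 3, Fin 3, Fin 3, andDealer, isCMSS_andDealer, entropy_andShares ?_, entropy_andShares ?_,
      entropy_andShares ?_⟩, logb_two_three_lt⟩
  all_goals
    simp only [andSharing]
    decide

end
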